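/- Let $p$ be a prime and $G=\mathbb Z/p^2\mathbb Z$. For a function $f:\mathbb Z/N\mathbb Z\to\mathbb C$ let $\widehat f(y)=\sum_{x}f(x)e^{-2\pi i xy/N}$, let $\operatorname{supp}(f)$ be the set where $f$ does not vanish, and for $1\le k\le p^2$ let $$\theta(k,G)=\min\{|\operatorname{supp}(\widehat f)| : f:G\to\mathbb C,\ f\neq 0,\ |\operatorname{supp}(f)|\le k\},$$ with the convention $\theta(0,G)=+\infty$. A nonzero function $f:G\to\mathbb C$ is called an equality case for $(k,G)$ if $|\operatorname{supp}(f)|=k$ and $|\operatorname{supp}(\widehat f)|=\theta(k,G)$. Let $H=\{pj: 0\le j\le p-1\}\subset G$, and let $\delta_A$ denote the characteristic function of a set $A$, with $\delta_x=\delta_{\{x\}}$. Then $$\theta(k,G)=\begin{cases}p(p-k+1) & \text{for } 1\le k\le p,\\ p-\lfloor k/p\rfloor+1 & \text{for } p\le k\le p^2.\end{cases}$$ Moreover, for $1\le k\le p^2$, there are equality cases for $(k,G)$ if and only if $\theta(k,G)<\theta(k-1,G)$ or $k=p^2-1$. They are described as follows. 1. For $1\le k\le p$, a function $f:G\to\mathbb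 C$ is an equality case for $(k,G)$ if and only if $$f(px+x')=g(x)\,\delta_{a+H}(x'),\qquad x,x'=0,\dots,p-1,$$ for some $a\in\{0,\dots,p-1\}$ and some $g:\mathbb Z/p\mathbb Z\to\mathbb C$ with $|\operatorname{supp}(g)|=k$ and $|\operatorname{supp}(\widehat g)|=p-k+1$. 2. For $p\le k\le p^2$, there are equality cases for $(k,G)$ if and only if $k$ is divisible by $p$ or $k=p^2-1$. For $k=pr$ with $1\le r\le p$, a function $f:G\to\mathbb C$ is an equality case for $(k,G)$ if and only if $$f(px+x')=\chi(px+x')\,g(x'),\qquad x,x'=0,\dots,p-1,$$ for some character $\chi$ of $G$ and some $g:\mathbb Z/p\mathbb Z\to\mathbb C$ with $|\operatorname{supp}(g)|=r$ and $|\operatorname{supp}(\widehat g)|=p-r+1$. For $k=p^2-1$, a function $f:G\to\mathbb C$ is an equality case for $(k,G)$ if and only if $$\widehat f=\alpha\,\chi\,(\delta_x-\delta_y)$$ for some nonzero constant $\alpha\in\mathbb C$, some character $\chi$ of $G$, and some $x,y\in G$ with $x-y\notin H$. -/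

import Mathlib

/-- `setE N k l`: the functions on `ℤ/Nℤ` with support of size at most `k` and spectrum (support of
the Fourier transform) of size exactly `l`. -/
def setE (N : ℕ) [NeZero N] (k l : ℕ) : Set (ZMod N → ℂ) :=
  {f | (Function.support f).ncard ≤ k ∧ (Function.support (ZMod.dft f)).ncard = l}

/-- `setE₀ N k l`: the functions on `ℤ/Nℤ` with support of size exactly `k` and spectrum of size
exactly `l`. -/
def setE₀ (N : ℕ) [NeZero N] (k l : ℕ) : Set (ZMod N → ℂ) :=
  {f | (Function.support f).ncard = k ∧ (Function.support (ZMod.dft f)).ncard = l}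

/-- Meshulam's function `θ(k, ℤ/Nℤ)` for `1 ≤ k ≤ N`: the least size of the spectrum of a nonzero
function whose support has size at most `k`. -/
noncomputable def meshulam (N : ℕ) [NeZero N] (k : ℕ) : ℕ :=
  sInf {l | ∃ f ∈ setE N k l, f ≠ 0}

/-- There are equality cases for `(k, ℤ/Nℤ)`. -/
def HasEqualityCases (N : ℕ) [NeZero N] (k : ℕ) : Prop :=
  (setE₀ N k (meshulam N k)).Nonempty

/-- `f` is an equality case for `(k, ℤ/Nℤ)`. -/
def IsEqualityCase (N : ℕ) [NeZero N] (k : ℕ) (f : ZMod N → ℂ) : Prop :=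
  f ≠ 0 ∧ f ∈ setE₀ N k (meshulam N k)

/-- The subgroup `H = {pj : j = 0, …, p - 1}` of `ℤ/p²ℤ`. -/
def subgroupH (p : ℕ) : AddSubgroup (ZMod (p ^ 2)) :=
  AddSubgroup.zmultiples (p : ZMod (p ^ 2))

/-- The coset `a + H` in `ℤ/p²ℤ`. -/
def cosetH (p : ℕ) (a : ZMod (p ^ 2)) : Set (ZMod (p ^ 2)) :=
  {z | ∃ h ∈ subgroupH p, z = a + h}

/-- The characteristic function `δ_A` of a subset `A`. -/
noncomputable def deltaSet {G : Type*} (A : Set G) : G → ℂ :=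
  A.indicator (fun _ => 1)

/-! Sort the points of `ℤ/p²ℤ` by residue mod `p`. Let the support of `f` meet `m` cosets of `H`,
with `s` the least number of points on a coset it meets, and let the spectrum meet `n` cosets. The
transform on `ℤ/p²ℤ` factors into two transforms on `ℤ/pℤ`, with nonvanishing twists in between
(`slice_dft`). Applying the uncertainty inequality of `ℤ/pℤ`, `|supp g| + |supp ĝ| ≥ p + 1`, to each
gives `n ≥ p + 1 - s` and at least `p + 1 - m` spectral points on each coset that the spectrum
meets. With `m s ≤ |supp f|`, the values of `θ` follow by elementary algebra; functions on one coset
and functions of the residue attain them. The inequality on `ℤ/pℤ` is a form of Chebotarev's theorem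
that the minors of the Fourier matrix do not vanish, proved here by reduction modulo `ω - 1`.

Equality in the algebra leaves the expected families and a degenerate case in which the support, or
the spectrum, has one point on each coset it meets. That case is governed by a rigidity statement
(`redMod_eq_of_dft_eq_zero`): if the transform of such a function has as many zeros as possible on
one coset, it has none elsewhere. The zeros force the values to lie in `ℚ(ζ_p)` up to a scalar, and
a zero on another coset would be a relation of degree less than `p` over `ℚ(ζ_p)` for a primitive
`p²`-th root of unity, whose degree over that field is `p`. For `k ≤ p` this excludes the degenerate
case; for `k ≥ p` it leaves only `k = p² - 1`. -/

/-! ### Sparse polynomials and Chebotarev's theorem on Fourier minors. -/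

open Polynomial in
-- The operator `X d/dX` multiplies the `i`-th coefficient by `i` and lowers the order of vanishing
-- at `1` by at most one. Iterating it and evaluating at `1` gives the power sums `∑ P_i i^j = 0`
-- for `j < n`, a Vandermonde system; its nodes are distinct mod `p` because the exponents are below
-- `p`.
theorem Polynomial.eq_zero_of_X_sub_one_pow_dvd {F : Type*} [CommRing F] [IsDomain F] {p : ℕ}
    [Fact p.Prime] [CharP F p] {P : F[X]} (hdeg : ∀ i ∈ P.support, i < p)
    {n : ℕ} (hn : P.support.card ≤ n) (hdvd : (X - 1) ^ n ∣ P) : P = 0 := by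
  have hθ : ∀ j ≤ n, ∃ Q : F[X], (X - 1) ^ (n - j) ∣ Q ∧
      ∀ i, Q.coeff i = (i : F) ^ j * P.coeff i := by
    intro j
    induction j with
    | zero => exact fun _ => ⟨P, by simpa using hdvd, by simp⟩
    | succ j ih =>
      intro hj
      obtain ⟨Q, ⟨S, hS⟩, hQ⟩ := ih (by omega)
      refine ⟨X * derivative Q, ?_, ?_⟩
      · have : n - j = (n - (j + 1)) + 1 := by omega
        rw [hS, this]
        refine Dvd.dvd.mul_left ?_ _
        rw [derivative_mul, derivative_pow]
        refine dvd_add ?_ ?_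
        · simp only [Nat.add_sub_cancel]
          exact Dvd.dvd.mul_right (Dvd.dvd.mul_right (Dvd.intro_left _ rfl) _) _
        · exact Dvd.dvd.mul_right (pow_dvd_pow _ (by omega)) _
      · intro i
        cases i with
        | zero => simp
        | succ i => rw [coeff_X_mul, coeff_derivative, hQ]; push_cast; ring
  have hsum : ∀ j < n, ∑ i ∈ P.support, P.coeff i * (i : F) ^ j = 0 := by
    intro j hj
    obtain ⟨Q, hQd, hQ⟩ := hθ j hj.le
    have h1 : Q.eval 1 = 0 := by
      refine eval_eq_zero_of_dvd_of_eval_eq_zero hQd ?_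
      rw [eval_pow]
      simp [show n - j ≠ 0 by omega]
    rw [eval_eq_sum, sum_def] at h1
    simp only [one_pow, mul_one] at h1
    rw [← h1]
    symm
    rw [Finset.sum_subset (s₂ := P.support)]
    · exact Finset.sum_congr rfl fun i _ => by rw [hQ, mul_comm]
    · intro i hi
      rw [mem_support_iff] at hi ⊢
      intro h
      exact hi (by rw [hQ, h, mul_zero])
    · intro i _ hi
      simpa using hi
  let e := P.support.equivFin
  have hinj : Function.Injective fun j : Fin P.support.card => (((e.symm j : ℕ)) : F) := by
    intro a b hab
    have ha := hdeg _ (e.symm a).2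
    have hb := hdeg _ (e.symm b).2
    have := (CharP.natCast_eq_natCast F p).1 hab
    have h2 : ((e.symm a : ℕ)) = e.symm b := Nat.ModEq.eq_of_lt_of_lt this ha hb
    exact e.symm.injective (Subtype.ext h2)
  have hv := Matrix.eq_zero_of_forall_pow_sum_mul_pow_eq_zero
    (v := fun j => P.coeff (e.symm j)) hinj (by
      intro i
      rw [← hsum i (i.2.trans_le hn), ← Finset.sum_coe_sort P.support]
      exact Equiv.sum_comp e.symm (fun a : P.support => P.coeff a * ((a : ℕ) : F) ^ (i : ℕ)))
  by_contra hP
  obtain ⟨i, hi⟩ := Finset.nonempty_iff_ne_empty.2 (mt support_eq_empty.1 hP)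
  have := congr_fun hv (e ⟨i, hi⟩)
  simp only [Equiv.symm_apply_apply, Pi.zero_apply] at this
  exact mem_support_iff.1 hi this

open Polynomial in
-- Infinite descent: modulo `π` the product of the `X - b` becomes a power of `X - 1`, so the
-- reduction vanishes by the previous lemma. Dividing by `π` keeps support and roots, hence every
-- power of `π` divides every coefficient.
theorem Polynomial.eq_zero_of_roots_congr_one {R : Type*} [CommRing R] [IsDomain R]
    [IsNoetherianRing R] {p : ℕ} [Fact p.Prime] {π : R} (hπ : Prime π)
    (hp : π ∣ (p : R)) {P : R[X]} (hdeg : ∀ i ∈ P.support, i < p) (B : Finset R)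
    (hB : ∀ b ∈ B, π ∣ b - 1 ∧ P.eval b = 0) (hcard : P.support.card ≤ B.card) : P = 0 := by
  by_contra hP
  let I := Ideal.span {π}
  have hI : I.IsPrime := (Ideal.span_singleton_prime hπ.ne_zero).2 hπ
  let q := Ideal.Quotient.mk I
  have hq : ∀ x, q x = 0 ↔ π ∣ x := fun x => by
    rw [Ideal.Quotient.eq_zero_iff_mem, Ideal.mem_span_singleton]
  have hchar : CharP (R ⧸ I) p := by
    refine (CharP.charP_iff_prime_eq_zero Fact.out).2 ?_
    rw [← map_natCast q, hq]
    exact hp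
  have key : ∀ Q : R[X], Q ≠ 0 → (∀ i ∈ Q.support, i < p) → (∀ b ∈ B, Q.eval b = 0) →
      Q.support.card ≤ B.card → C π ∣ Q := by
    intro Q hQ hd hroot hc
    have h1 : (∏ b ∈ B, (X - C b)) ∣ Q := by
      have := (Multiset.prod_X_sub_C_dvd_iff_le_roots hQ B.val).2 (by
        rw [Multiset.le_iff_subset B.nodup]
        intro b hb
        exact (mem_roots hQ).2 (hroot b hb))
      exact this
    have h2 := Polynomial.map_dvd q h1
    have h3 : (∏ b ∈ B, (X - C b)).map q = (X - 1) ^ B.card := by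
      rw [Polynomial.map_prod, Finset.prod_congr rfl (g := fun _ => (X - 1 : (R ⧸ I)[X])),
        Finset.prod_const]
      intro b hb
      have : q b = 1 := by
        have := (hq _).2 (hB b hb).1
        rwa [map_sub, map_one, sub_eq_zero] at this
      simp [this]
    rw [h3] at h2
    have h4 : Q.map q = 0 := by
      refine eq_zero_of_X_sub_one_pow_dvd (p := p) (fun i hi => hd i ?_) ?_ h2
      · exact support_map_subset _ _ hi
      · exact (Finset.card_le_card (support_map_subset _ _)).trans hc
    rw [C_dvd_iff_dvd_coeff]
    intro i
    rw [← hq, ← coeff_map, h4, coeff_zero]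
  have hall : ∀ m, C (π ^ m) ∣ P := by
    intro m
    induction m with
    | zero => simp
    | succ m ih =>
      obtain ⟨Q, hQ⟩ := ih
      have hm : π ^ m ≠ 0 := pow_ne_zero _ hπ.ne_zero
      have hsupp : Q.support = P.support := by
        ext i
        rw [mem_support_iff, mem_support_iff, hQ, coeff_C_mul]
        simp [hm]
      obtain ⟨S, hS⟩ := key Q (by rintro rfl; simp at hQ; exact hP hQ)
        (by rwa [hsupp]) (fun b hb => by
          have := (hB b hb).2
          rw [hQ, eval_mul, eval_C] at this
          exact (mul_eq_zero.1 this).resolve_left hm) (by rwa [hsupp])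
      exact ⟨S, by rw [hQ, hS, pow_succ, C_mul, mul_assoc]⟩
  obtain ⟨i, hi⟩ := Finset.nonempty_iff_ne_empty.2 (mt support_eq_empty.1 hP)
  have hfin := FiniteMultiplicity.of_not_isUnit hπ.not_isUnit (mem_support_iff.1 hi)
  obtain ⟨m, hm⟩ := hfin
  exact hm ((C_dvd_iff_dvd_coeff _ _).1 (hall (m + 1)) i)

theorem IsPrimitiveRoot.isCyclotomicExtension_adjoin_simple {L : Type*} [Field L] [CharZero L]
    {n : ℕ} [NeZero n] {ζ : L} (hζ : IsPrimitiveRoot ζ n) :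
    IsCyclotomicExtension {n} ℚ (IntermediateField.adjoin ℚ {ζ}) := by
  change IsCyclotomicExtension {n} ℚ (IntermediateField.adjoin ℚ {ζ}).toSubalgebra
  rw [IntermediateField.adjoin_simple_toSubalgebra_of_isAlgebraic
    ((hζ.isIntegral (NeZero.pos n)).tower_top (A := ℚ)).isAlgebraic]
  exact hζ.adjoin_isCyclotomicExtension ℚ

theorem ZMod.isPrimitiveRoot_stdAddChar (N : ℕ) [NeZero N] {a : ZMod N} (ha : IsUnit a) :
    IsPrimitiveRoot (ZMod.stdAddChar a) N := by
  have h : ∀ l : ℕ, ZMod.stdAddChar a ^ l = 1 ↔ N ∣ l := by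
    intro l
    rw [← AddChar.map_nsmul_eq_pow, ← AddChar.map_zero_eq_one (ZMod.stdAddChar (N := N)),
      ZMod.injective_stdAddChar.eq_iff, nsmul_eq_mul, ha.mul_left_eq_zero,
      ZMod.natCast_eq_zero_iff]
  exact ⟨(h N).2 dvd_rfl, fun l hl => (h l).1 hl⟩

theorem ZMod.stdAddChar_neg_mul {N : ℕ} [NeZero N] (a b : ZMod N) :
    ZMod.stdAddChar (-(a * b)) = ZMod.stdAddChar (-1 : ZMod N) ^ (a.val * b.val) := by
  rw [← AddChar.map_nsmul_eq_pow]
  simp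

/-- A submatrix of the Fourier matrix of `ℤ/pℤ` which is not injective over `ℂ` has too few rows. -/
theorem ZMod.card_lt_card_of_dft_eq_zero {p : ℕ} [Fact p.Prime] {g : ZMod p → ℂ} (hg : g ≠ 0)
    {A B : Finset (ZMod p)} (hA : ∀ a, g a ≠ 0 → a ∈ A) (hB : ∀ b ∈ B, ZMod.dft g b = 0) :
    B.card < A.card := by
  classical
  by_contra! hcard
  obtain ⟨B', hB', hcard'⟩ := Finset.exists_subset_card_eq hcard
  set z : ℂ := ZMod.stdAddChar (-1 : ZMod p) with hz
  have hzp : IsPrimitiveRoot z p := ZMod.isPrimitiveRoot_stdAddChar p isUnit_one.neg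
  let K := IntermediateField.adjoin ℚ {z}
  have : IsCyclotomicExtension {p} ℚ K := hzp.isCyclotomicExtension_adjoin_simple
  have : NumberField K := IsCyclotomicExtension.numberField {p} ℚ K
  let ζ : K := ⟨z, IntermediateField.mem_adjoin_simple_self ℚ z⟩
  have hζ : IsPrimitiveRoot ζ p :=
    IsPrimitiveRoot.of_map_of_injective (f := algebraMap K ℂ) hzp (algebraMap K ℂ).injective
  let R := NumberField.RingOfIntegers K
  let ω : R := hζ.toInteger
  have hω : IsPrimitiveRoot ω p := hζ.toInteger_isPrimitiveRoot
  have hπ : Prime (ω - 1) := hζ.zeta_sub_one_prime'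
  have hdvd : ∀ i : ℕ, ω - 1 ∣ ω ^ i - 1 := fun i => by
    simpa using sub_dvd_pow_sub_pow ω 1 i
  have hp : ω - 1 ∣ (p : R) := by
    have h0 := hω.geom_sum_eq_zero (Fact.out : p.Prime).one_lt
    have h1 : (p : R) = - ∑ i ∈ Finset.range p, (ω ^ i - 1) := by
      rw [Finset.sum_sub_distrib, h0, zero_sub, neg_neg, Finset.sum_const, Finset.card_range,
        nsmul_one]
    rw [h1, dvd_neg]
    exact Finset.dvd_sum fun i _ => hdvd i
  let σ : R →+* ℂ := (algebraMap K ℂ).comp (algebraMap R K)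
  have hσ : Function.Injective σ :=
    (algebraMap K ℂ).injective.comp NumberField.RingOfIntegers.coe_injective
  have hσω : σ ω = z := rfl
  let e : A ≃ B' := Finset.equivOfCardEq hcard'.symm
  let M : Matrix A A R := fun i j => ω ^ ((j : ZMod p).val * (e i : ZMod p).val)
  -- The kernel vector `g` is only complex; passing through the determinant replaces it by a kernel
  -- vector `v` with entries in the ring of integers, where reduction makes sense.
  have hdet : M.det = 0 := by
    apply hσ
    rw [map_zero, RingHom.map_det, ← Matrix.exists_mulVec_eq_zero_iff]
    refine ⟨fun a => g a, ?_, ?_⟩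
    · intro h
      apply hg
      funext a
      by_contra ha
      exact ha (congr_fun h ⟨a, hA a ha⟩)
    · funext i
      have := hB _ (hB' (e i).2)
      rw [ZMod.dft_apply] at this
      rw [Pi.zero_apply, ← this, Matrix.mulVec, dotProduct,
        ← Finset.sum_subset (Finset.subset_univ A), ← Finset.sum_coe_sort A]
      · refine Finset.sum_congr rfl fun j _ => ?_
        rw [ZMod.stdAddChar_neg_mul, smul_eq_mul]
        congr 1
      · intro x _ hx
        rw [not_imp_comm.1 (hA x) hx, smul_zero]
  obtain ⟨v, hv, hMv⟩ := Matrix.exists_mulVec_eq_zero_iff.2 hdet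
  have hval : Function.Injective (ZMod.val : ZMod p → ℕ) := ZMod.val_injective p
  let P : Polynomial R := ∑ a : A, Polynomial.monomial (a : ZMod p).val (v a)
  have hcoeff : ∀ a : A, P.coeff (a : ZMod p).val = v a := by
    intro a
    simp only [P, Polynomial.finsetSum_coeff, Polynomial.coeff_monomial]
    rw [Finset.sum_eq_single a]
    · simp
    · intro b _ hb
      rw [if_neg]
      intro h
      exact hb (Subtype.ext (hval h))
    · simp
  have hsupp : P.support ⊆ A.image ZMod.val := by
    intro i hi
    rw [Polynomial.mem_support_iff] at hi
    by_contra h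
    apply hi
    simp only [P, Polynomial.finsetSum_coeff, Polynomial.coeff_monomial]
    refine Finset.sum_eq_zero fun a _ => if_neg fun h' => h ?_
    exact Finset.mem_image.2 ⟨a, a.2, h'⟩
  have hP : P = 0 := by
    refine Polynomial.eq_zero_of_roots_congr_one (p := p) hπ hp ?_
      (B'.image fun b => ω ^ b.val) ?_ ?_
    · intro i hi
      obtain ⟨a, -, rfl⟩ := Finset.mem_image.1 (hsupp hi)
      exact ZMod.val_lt a
    · intro x hx
      obtain ⟨b, hb, rfl⟩ := Finset.mem_image.1 hx
      refine ⟨hdvd _, ?_⟩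
      have h1 := congr_fun hMv (e.symm ⟨b, hb⟩)
      rw [Pi.zero_apply, Matrix.mulVec, dotProduct] at h1
      rw [← h1, Polynomial.eval_finsetSum]
      refine Finset.sum_congr rfl fun a _ => ?_
      simp only [Polynomial.eval_monomial, M, Equiv.apply_symm_apply]
      rw [mul_comm, ← pow_mul, mul_comm b.val]
    · rw [Finset.card_image_of_injOn, hcard']
      · exact (Finset.card_le_card hsupp).trans Finset.card_image_le
      · intro a _ b _ hab
        exact hval (hω.pow_inj (ZMod.val_lt a) (ZMod.val_lt b) hab)
  apply hv
  funext a
  rw [← hcoeff a, hP, Polynomial.coeff_zero, Pi.zero_apply]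

/-! ### The uncertainty inequality on `ℤ/pℤ` and its sharpness. -/

theorem ZMod.lt_ncard_support_add_ncard_support_dft {p : ℕ} [Fact p.Prime] {g : ZMod p → ℂ}
    (hg : g ≠ 0) :
    p + 1 ≤ (Function.support g).ncard + (Function.support (ZMod.dft g)).ncard := by
  classical
  rw [Set.ncard_eq_toFinset_card', Set.ncard_eq_toFinset_card']
  have h := ZMod.card_lt_card_of_dft_eq_zero hg (A := (Function.support g).toFinset)
    (B := (Function.support (ZMod.dft g)).toFinsetᶜ) (by simp) (by simp)
  rw [Finset.card_compl, ZMod.card] at h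
  omega

/-- Fewer equations than unknowns. The system is solved over `K`, so that the rigidity argument can
take a solution with cyclotomic values. -/
theorem ZMod.exists_ne_zero_dft_eq_zero {p : ℕ} [Fact p.Prime] (K : Subfield ℂ)
    (hK : ∀ j : ZMod p, ZMod.stdAddChar j ∈ K) {A T : Finset (ZMod p)} (h : T.card < A.card) :
    ∃ d : ZMod p → ℂ, d ≠ 0 ∧ (∀ a, d a ∈ K) ∧ (∀ a, d a ≠ 0 → a ∈ A) ∧
      ∀ b ∈ T, ZMod.dft d b = 0 := by
  classical
  let M : Matrix T A K := fun b a => ⟨ZMod.stdAddChar (-((a : ZMod p) * (b : ZMod p))), hK _⟩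
  have hker : LinearMap.ker M.mulVecLin ≠ ⊥ := by
    refine LinearMap.ker_ne_bot_of_finrank_lt ?_
    simpa using h
  obtain ⟨v, hv, hv0⟩ := Submodule.exists_mem_ne_zero_of_ne_bot hker
  let d : ZMod p → ℂ := fun a => if ha : a ∈ A then (v ⟨a, ha⟩ : ℂ) else 0
  have hd : ∀ a : A, d a = v a := fun a => by simp [d]
  refine ⟨d, ?_, ?_, ?_, ?_⟩
  · intro h0
    apply hv0
    funext a
    have := congr_fun h0 a
    rw [hd] at this
    exact Subtype.ext this
  · intro a
    by_cases ha : a ∈ A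
    · simp only [d, ha, dif_pos]
      exact SetLike.coe_mem _
    · simp only [d, ha, dif_neg, not_false_eq_true]
      exact K.zero_mem
  · intro a ha
    by_contra h'
    exact ha (by simp [d, h'])
  · intro b hb
    have h1 := congr_fun (LinearMap.mem_ker.1 hv) ⟨b, hb⟩
    rw [Matrix.mulVecLin_apply, Matrix.mulVec, dotProduct] at h1
    have h2 := congr_arg (Subtype.val : K → ℂ) h1
    rw [ZMod.dft_apply, ← Finset.sum_subset (Finset.subset_univ A), ← Finset.sum_coe_sort A]
    · rw [Pi.zero_apply, ZeroMemClass.coe_zero, AddSubmonoidClass.coe_finsetSum] at h2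
      rw [← h2]
      refine Finset.sum_congr rfl fun a _ => ?_
      rw [hd]
      rfl
    · intro x _ hx
      simp [d, hx]

/-- The uncertainty inequality on `ℤ/pℤ` is attained at every support size. -/
theorem ZMod.exists_ncard_support_dft_eq {p : ℕ} [Fact p.Prime] {r : ℕ} (h1 : 1 ≤ r)
    (hr : r ≤ p) :
    ∃ g : ZMod p → ℂ, (Function.support g).ncard = r ∧
      (Function.support (ZMod.dft g)).ncard = p - r + 1 := by
  classical
  obtain ⟨A, -, hA⟩ := Finset.exists_subset_card_eq
    (s := (Finset.univ : Finset (ZMod p))) (n := r) (by simpa using hr)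
  obtain ⟨T, -, hT⟩ := Finset.exists_subset_card_eq
    (s := (Finset.univ : Finset (ZMod p))) (n := r - 1) (by simp; omega)
  obtain ⟨g, hg, -, hgA, hgT⟩ := ZMod.exists_ne_zero_dft_eq_zero (⊤ : Subfield ℂ)
    (fun _ => Subfield.mem_top _) (A := A) (T := T) (by omega)
  have hlow := ZMod.lt_ncard_support_add_ncard_support_dft hg
  have ha : (Function.support g).ncard ≤ r := by
    rw [← hA, ← Set.ncard_coe_finset]
    exact Set.ncard_le_ncard hgA
  have hb : (Function.support (ZMod.dft g)).ncard ≤ p - (r - 1) := by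
    have hcompl : Tᶜ.card = p - (r - 1) := by rw [Finset.card_compl, ZMod.card, hT]
    rw [← hcompl, ← Set.ncard_coe_finset]
    refine Set.ncard_le_ncard fun x hx => ?_
    simp only [Finset.coe_compl, Set.mem_compl_iff, Finset.mem_coe]
    exact fun h => hx (hgT x h)
  exact ⟨g, by omega, by omega⟩

/-! ### The degree of a primitive `p²`-th root of unity over `ℚ(ζ_p)`. -/

open IntermediateField in
-- Compare degrees over `ℚ`: `φ(p²) = p (p - 1)` is at most `φ(p) = p - 1` times the relative
-- degree.
theorem IsPrimitiveRoot.le_natDegree_minpoly_adjoin_pow {L : Type*} [Field L] [CharZero L] {p : ℕ}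
    [Fact p.Prime] {ω z : L} (hω : IsPrimitiveRoot ω (p ^ 2)) (hz : IsPrimitiveRoot z p) :
    p ≤ (minpoly ℚ⟮z⟯ ω).natDegree := by
  have hp : p.Prime := Fact.out
  have := hz.isCyclotomicExtension_adjoin_simple
  have := hω.isCyclotomicExtension_adjoin_simple
  have hfz : Module.finrank ℚ ℚ⟮z⟯ = p.totient := IsCyclotomicExtension.Rat.finrank p _
  have hfω : Module.finrank ℚ ℚ⟮ω⟯ = (p ^ 2).totient := IsCyclotomicExtension.Rat.finrank (p ^ 2) _
  rw [Nat.totient_prime hp] at hfz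
  rw [Nat.totient_prime_pow hp two_pos] at hfω
  have hpos : 0 < p - 1 := by have := hp.two_le; omega
  have : FiniteDimensional ℚ ℚ⟮z⟯ := Module.finite_of_finrank_pos (by omega)
  have hint : IsIntegral ℚ⟮z⟯ ω := (hω.isIntegral (NeZero.pos (p ^ 2))).tower_top
  have hf := IntermediateField.adjoin.finrank hint
  have : FiniteDimensional ℚ⟮z⟯ ℚ⟮z⟯⟮ω⟯ := IntermediateField.adjoin.finiteDimensional hint
  have : FiniteDimensional ℚ ℚ⟮z⟯⟮ω⟯ := FiniteDimensional.trans ℚ ℚ⟮z⟯ ℚ⟮z⟯⟮ω⟯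
  have hmul := Module.finrank_mul_finrank ℚ ℚ⟮z⟯ ℚ⟮z⟯⟮ω⟯
  have hle : ℚ⟮ω⟯ ≤ (ℚ⟮z⟯⟮ω⟯).restrictScalars ℚ := by
    rw [IntermediateField.adjoin_simple_le_iff]
    exact IntermediateField.mem_adjoin_simple_self _ ω
  have hle2 : Module.finrank ℚ ℚ⟮ω⟯ ≤ Module.finrank ℚ ℚ⟮z⟯⟮ω⟯ :=
    LinearMap.finrank_le_finrank_of_injective
      (f := (IntermediateField.inclusion hle).toLinearMap)
      (IntermediateField.inclusion hle).injective
  rw [hfω, ← hmul, hfz, hf] at hle2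
  simp only [Nat.reduceSub, pow_one] at hle2
  rw [mul_comm] at hle2
  exact Nat.le_of_mul_le_mul_left hle2 hpos

open IntermediateField in
theorem IsPrimitiveRoot.eq_zero_of_sum_mul_pow_eq_zero {L : Type*} [Field L] [CharZero L] {p : ℕ}
    [Fact p.Prime] {ω z : L} (hω : IsPrimitiveRoot ω (p ^ 2)) (hz : IsPrimitiveRoot z p)
    {κ : ZMod p → L} (hκ : ∀ u, κ u ∈ ℚ⟮z⟯) (hsum : ∑ u, κ u * ω ^ u.val = 0) (u : ZMod p) :
    κ u = 0 := by
  let P : Polynomial ℚ⟮z⟯ := ∑ u : ZMod p, Polynomial.monomial u.val ⟨κ u, hκ u⟩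
  have hdeg : P.degree < p := by
    rw [Polynomial.degree_lt_iff_coeff_zero]
    intro m hm
    simp only [P, Polynomial.finsetSum_coeff, Polynomial.coeff_monomial]
    refine Finset.sum_eq_zero fun a _ => if_neg ?_
    have := ZMod.val_lt a
    omega
  have hP : P = 0 := by
    by_contra hP
    have h0 : Polynomial.aeval ω P = 0 := by
      rw [← hsum]
      simp only [P, map_sum, Polynomial.aeval_monomial]
      rfl
    have h1 := minpoly.degree_le_of_ne_zero _ ω hP h0
    have hint : IsIntegral ℚ⟮z⟯ ω := (hω.isIntegral (NeZero.pos (p ^ 2))).tower_top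
    rw [Polynomial.degree_eq_natDegree (minpoly.ne_zero hint)] at h1
    have h2 := hω.le_natDegree_minpoly_adjoin_pow hz
    have h3 := h1.trans_lt hdeg
    rw [Nat.cast_lt] at h3
    omega
  have hc : P.coeff u.val = ⟨κ u, hκ u⟩ := by
    simp only [P, Polynomial.finsetSum_coeff, Polynomial.coeff_monomial]
    rw [Finset.sum_eq_single u]
    · simp
    · intro b _ hb
      exact if_neg fun h => hb (ZMod.val_injective p h)
    · simp
  rw [hP, Polynomial.coeff_zero] at hc
  exact (congr_arg Subtype.val hc).symm

/-! ### Reduction mod `p` and rigidity of zeros. -/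

/-- Reduction `ℤ/p²ℤ → ℤ/pℤ`. -/
def redMod (p : ℕ) : ZMod (p ^ 2) →+* ZMod p := ZMod.castHom (dvd_pow_self p two_ne_zero) (ZMod p)

theorem redMod_natCast_val {p : ℕ} [NeZero p] (y : ZMod (p ^ 2)) :
    ((y.val : ℕ) : ZMod p) = redMod p y := by
  rw [← map_natCast (redMod p), ZMod.natCast_zmod_val]

theorem redMod_val {p : ℕ} [NeZero p] (y : ZMod (p ^ 2)) : (redMod p y).val = y.val % p := by
  rw [← redMod_natCast_val, ZMod.val_natCast]

theorem stdAddChar_natCast_mul {p : ℕ} [NeZero p] (y : ZMod (p ^ 2)) :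
    ZMod.stdAddChar ((p : ZMod (p ^ 2)) * y) = ZMod.stdAddChar (redMod p y) := by
  obtain ⟨m, rfl⟩ := ZMod.intCast_surjective y
  have hp : (p : ℂ) ≠ 0 := NeZero.ne _
  rw [map_intCast, ZMod.stdAddChar_coe, ← Int.cast_natCast p, ← Int.cast_mul, ZMod.stdAddChar_coe]
  congr 1
  push_cast
  field_simp

theorem isUnit_of_redMod_ne_zero {p : ℕ} [Fact p.Prime] {y : ZMod (p ^ 2)} (h : redMod p y ≠ 0) :
    IsUnit y := by
  rw [← ZMod.natCast_zmod_val y, ZMod.isUnit_iff_coprime]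
  refine Nat.Coprime.pow_right _ (Nat.Coprime.symm ?_)
  rw [(Fact.out : p.Prime).coprime_iff_not_dvd, ← ZMod.natCast_eq_zero_iff, redMod_natCast_val]
  exact h

theorem ZMod.addChar_apply_ne_zero {N : ℕ} (χ : AddChar (ZMod N) ℂ) (a : ZMod N) : χ a ≠ 0 := by
  intro h
  have := χ.map_add_eq_mul a (-a)
  rw [add_neg_cancel, AddChar.map_zero_eq_one, h, zero_mul] at this
  exact one_ne_zero this

theorem ZMod.dft_stdAddChar_mul {N : ℕ} [NeZero N] (b : ZMod N) (f : ZMod N → ℂ) (x : ZMod N) :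
    ZMod.dft (fun y => ZMod.stdAddChar (b * y) * f y) x = ZMod.dft f (x - b) := by
  simp only [ZMod.dft_apply, smul_eq_mul, ← mul_assoc, ← AddChar.map_add_eq_mul]
  refine Finset.sum_congr rfl fun y _ => ?_
  ring_nf

open IntermediateField in
-- The transform on `H` is that of the push-forward `d` of `c` to `ℤ/pℤ`. Its zeros determine `d` up
-- to a scalar, and a solution over `ℚ(ζ_p)` exists, so `c` is a scalar multiple of a function with
-- values there. A zero off `H` would then violate the linear independence of `1, ω, …, ω^(p-1)`
-- over `ℚ(ζ_p)`.
theorem redMod_eq_zero_of_dft_eq_zero {p : ℕ} [Fact p.Prime] {c : ZMod (p ^ 2) → ℂ}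
    (hinj : Set.InjOn (redMod p) (Function.support c)) (hc : c ≠ 0) {T : Finset (ZMod p)}
    (hT : (Function.support c).ncard ≤ T.card + 1)
    (h0 : ∀ t ∈ T, ZMod.dft c ((p : ZMod (p ^ 2)) * ((t.val : ℕ) : ZMod (p ^ 2))) = 0)
    {x : ZMod (p ^ 2)} (hx : ZMod.dft c x = 0) : redMod p x = 0 := by
  classical
  have hfiber : ∀ (F : ZMod (p ^ 2) → ℂ), (∀ y, c y = 0 → F y = 0) → ∀ y, c y ≠ 0 →
      ∑ y' with redMod p y' = redMod p y, F y' = F y := by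
    intro F hF y hy
    rw [Finset.sum_eq_single_of_mem y (by simp)]
    intro b hb hby
    by_contra h
    exact hby (hinj (fun h' => h (hF b h')) hy (Finset.mem_filter.1 hb).2)
  let d : ZMod p → ℂ := fun u => ∑ y with redMod p y = u, c y
  have hdc : ∀ y, c y ≠ 0 → d (redMod p y) = c y := hfiber c fun _ h => h
  obtain ⟨y₀, hy₀⟩ := Function.ne_iff.1 hc
  let A : Finset (ZMod p) := (Function.support c).toFinset.image (redMod p)
  have hA : A.card = (Function.support c).ncard := by
    rw [Finset.card_image_of_injOn (by simpa using hinj), Set.ncard_eq_toFinset_card']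
  have hdA : ∀ u, d u ≠ 0 → u ∈ A := by
    intro u hu
    obtain ⟨y, hy, hyc⟩ := Finset.exists_ne_zero_of_sum_ne_zero hu
    exact Finset.mem_image.2 ⟨y, by simpa using hyc, (Finset.mem_filter.1 hy).2⟩
  have hA0 : 0 < A.card :=
    Finset.card_pos.2 ⟨redMod p y₀, Finset.mem_image.2 ⟨y₀, by simpa using hy₀, rfl⟩⟩
  have hdft : ∀ t : ZMod p,
      ZMod.dft d t = ZMod.dft c ((p : ZMod (p ^ 2)) * ((t.val : ℕ) : ZMod (p ^ 2))) := by
    intro t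
    simp only [ZMod.dft_apply, smul_eq_mul, d, Finset.mul_sum]
    rw [← Finset.sum_fiberwise Finset.univ (redMod p)]
    refine Finset.sum_congr rfl fun u _ => Finset.sum_congr rfl fun y hy => ?_
    have h1 : -(y * ((p : ZMod (p ^ 2)) * ((t.val : ℕ) : ZMod (p ^ 2)))) =
      (p : ZMod (p ^ 2)) * (-(y * (t.val : ℕ))) := by ring
    rw [h1, stdAddChar_natCast_mul, map_neg (redMod p), map_mul (redMod p), map_natCast (redMod p),
      ZMod.natCast_zmod_val,
      (Finset.mem_filter.1 hy).2]
  -- Exactly `|A| - 1` conditions: few enough for a nonzero solution, enough for uniqueness up to a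
  -- scalar.
  obtain ⟨T', hT'T, hT'⟩ := Finset.exists_subset_card_eq (s := T) (n := A.card - 1) (by omega)
  set z : ℂ := ZMod.stdAddChar (1 : ZMod p) with hz
  have hzp : IsPrimitiveRoot z p := ZMod.isPrimitiveRoot_stdAddChar p isUnit_one
  have hK : ∀ j : ZMod p, ZMod.stdAddChar j ∈ ℚ⟮z⟯ := by
    intro j
    have : ZMod.stdAddChar j = z ^ j.val := by
      rw [hz, ← AddChar.map_nsmul_eq_pow]; simp
    rw [this]
    exact pow_mem (IntermediateField.mem_adjoin_simple_self ℚ z) _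
  obtain ⟨d₀, hd₀, hd₀K, hd₀A, hd₀T⟩ := ZMod.exists_ne_zero_dft_eq_zero ℚ⟮z⟯.toSubfield hK
    (A := A) (T := T') (by omega)
  obtain ⟨a, ha⟩ := Function.ne_iff.1 hd₀
  -- The difference vanishes at `a`, so it is carried by `|A| - 1` points while its transform has
  -- `|A| - 1` zeros.
  have hprop : d = (d a / d₀ a) • d₀ := by
    by_contra hne
    have := ZMod.card_lt_card_of_dft_eq_zero (sub_ne_zero.2 hne) (A := A.erase a) (B := T') (by
      intro u hu
      refine Finset.mem_erase.2 ⟨?_, ?_⟩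
      · rintro rfl
        exact hu (by simp [div_mul_cancel₀ _ ha])
      · by_contra huA
        have h1 : d u = 0 := not_imp_comm.1 (hdA u) huA
        have h2 : d₀ u = 0 := not_imp_comm.1 (hd₀A u) huA
        exact hu (by simp [h1, h2])) (by
      intro b hb
      rw [map_sub, map_smul, Pi.sub_apply, Pi.smul_apply, hd₀T b hb, smul_zero, sub_zero, hdft,
        h0 b (hT'T hb)])
    rw [Finset.card_erase_of_mem (hd₀A a ha)] at this
    omega
  set l := d a / d₀ a with hl
  have hl0 : l ≠ 0 := by
    intro h
    rw [h, zero_smul] at hprop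
    have := hdc y₀ hy₀
    rw [hprop] at this
    exact hy₀ this.symm
  by_contra hxu
  have hω : IsPrimitiveRoot (ZMod.stdAddChar (-x)) (p ^ 2) :=
    ZMod.isPrimitiveRoot_stdAddChar (p ^ 2) (isUnit_of_redMod_ne_zero hxu).neg
  set ω : ℂ := ZMod.stdAddChar (-x) with hωdef
  have hωK : ω ^ p ∈ ℚ⟮z⟯ := by
    rw [hωdef, ← AddChar.map_nsmul_eq_pow, nsmul_eq_mul, stdAddChar_natCast_mul]
    exact hK _
  -- From `ω^y = (ω^p)^(y / p) ω^(y % p)` with `ω^p` in `ℚ(ζ_p)`. Each residue class holds at most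
  -- one point of the support, so no cancellation occurs within a coefficient `κ u`.
  let F : ZMod (p ^ 2) → ℂ := fun y => l⁻¹ * c y * (ω ^ p) ^ (y.val / p)
  let κ : ZMod p → ℂ := fun u => ∑ y with redMod p y = u, F y
  have hκK : ∀ u, κ u ∈ ℚ⟮z⟯ := by
    intro u
    refine sum_mem fun y _ => mul_mem ?_ (pow_mem hωK _)
    by_cases hy : c y = 0
    · rw [hy, mul_zero]; exact zero_mem _
    · rw [← hdc y hy, hprop, Pi.smul_apply, smul_eq_mul, inv_mul_cancel_left₀ hl0]
      exact hd₀K _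
  have hsum : ∑ u, κ u * ω ^ u.val = 0 := by
    have h1 : ∑ u, κ u * ω ^ u.val = l⁻¹ * ZMod.dft c x := by
      simp only [ZMod.dft_apply, smul_eq_mul, κ, Finset.sum_mul, Finset.mul_sum]
      rw [← Finset.sum_fiberwise Finset.univ (redMod p)]
      refine Finset.sum_congr rfl fun u _ => Finset.sum_congr rfl fun y hy => ?_
      have h2 : ZMod.stdAddChar (-(y * x)) = ω ^ y.val := by
        rw [hωdef, ← AddChar.map_nsmul_eq_pow]; simp
      rw [h2, ← (Finset.mem_filter.1 hy).2, redMod_val]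
      conv_rhs => rw [← Nat.div_add_mod y.val p, pow_add, pow_mul]
      ring
    rw [h1, hx, mul_zero]
  have h1 := hω.eq_zero_of_sum_mul_pow_eq_zero hzp hκK hsum (redMod p y₀)
  have h2 := hfiber F (fun y hy => by simp [F, hy]) y₀ hy₀
  have h3 : F y₀ = 0 := h2 ▸ h1
  simp only [F, mul_eq_zero, inv_eq_zero, hl0, false_or, pow_eq_zero_iff'] at h3
  rcases h3 with h | ⟨⟨h, -⟩, -⟩
  · exact hy₀ h
  · exact hω.ne_zero (NeZero.ne _) h

/-- If the support of `c` meets every coset of `pℤ/p²ℤ` in at most one point, and the Fourier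
transform of `c` has as many zeros as possible on some coset, then it has no others. -/
theorem redMod_eq_of_dft_eq_zero {p : ℕ} [Fact p.Prime] {c : ZMod (p ^ 2) → ℂ}
    (hinj : Set.InjOn (redMod p) (Function.support c)) (hc : c ≠ 0) {T : Finset (ZMod p)}
    (hT : (Function.support c).ncard ≤ T.card + 1) {x₀ : ZMod (p ^ 2)}
    (h0 : ∀ t ∈ T, ZMod.dft c ((p : ZMod (p ^ 2)) * ((t.val : ℕ) : ZMod (p ^ 2)) + x₀) = 0)
    {x : ZMod (p ^ 2)} (hx : ZMod.dft c x = 0) : redMod p x = redMod p x₀ := by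
  -- Modulation translates the transform and moves the coset of `x₀` to `H`.
  let c' : ZMod (p ^ 2) → ℂ := fun y => ZMod.stdAddChar (-x₀ * y) * c y
  have hs : Function.support c' = Function.support c := by
    ext y
    simp [c', ZMod.addChar_apply_ne_zero]
  have hdft : ∀ w, ZMod.dft c' w = ZMod.dft c (w + x₀) := fun w => by
    rw [ZMod.dft_stdAddChar_mul, sub_neg_eq_add]
  have := redMod_eq_zero_of_dft_eq_zero (c := c') (hs ▸ hinj)
    (Function.support_nonempty_iff.1 (hs ▸ Function.support_nonempty_iff.2 hc)) (T := T)
    (hs ▸ hT) (fun t ht => by rw [hdft, h0 t ht]) (x := x - x₀) (by rw [hdft, sub_add_cancel, hx])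
  rwa [map_sub, sub_eq_zero] at this

/-! ### Digits, slices and the factored Fourier transform. -/

/-- The bijection `(a, t) ↦ p t + a` of `(ℤ/pℤ)²` with `ℤ/p²ℤ` given by representatives. -/
def digits (p : ℕ) (a t : ZMod p) : ZMod (p ^ 2) :=
  (p : ZMod (p ^ 2)) * ((t.val : ℕ) : ZMod (p ^ 2)) + ((a.val : ℕ) : ZMod (p ^ 2))

theorem redMod_val_cast {p : ℕ} [NeZero p] (a : ZMod p) :
    redMod p ((a.val : ℕ) : ZMod (p ^ 2)) = a := by
  rw [map_natCast, ZMod.natCast_zmod_val]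

theorem redMod_digits {p : ℕ} [NeZero p] (a t : ZMod p) : redMod p (digits p a t) = a := by
  simp [digits]

theorem digits_eq_natCast {p : ℕ} (a t : ZMod p) :
    digits p a t = ((p * t.val + a.val : ℕ) : ZMod (p ^ 2)) := by
  simp [digits]

theorem digits_injective {p : ℕ} [NeZero p] :
    Function.Injective fun x : ZMod p × ZMod p => digits p x.1 x.2 := by
  rintro ⟨a, t⟩ ⟨a', t'⟩ h
  obtain rfl : a = a' := by simpa only [redMod_digits] using congr_arg (redMod p) h
  have h1 : ((p * t.val : ℕ) : ZMod (p ^ 2)) = ((p * t'.val : ℕ) : ZMod (p ^ 2)) := by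
    have := add_right_cancel h
    exact_mod_cast this
  have hlt : ∀ u : ZMod p, p * u.val < p ^ 2 := fun u => by
    rw [pow_two]
    exact Nat.mul_lt_mul_of_pos_left (ZMod.val_lt u) (NeZero.pos p)
  have h2 := Nat.ModEq.eq_of_lt_of_lt ((ZMod.natCast_eq_natCast_iff _ _ _).1 h1) (hlt t) (hlt t')
  have h3 := Nat.eq_of_mul_eq_mul_left (NeZero.pos p) h2
  rw [ZMod.val_injective p h3]

/-- `digits` as an equivalence. -/
noncomputable def digitsEquiv (p : ℕ) [NeZero p] : ZMod p × ZMod p ≃ ZMod (p ^ 2) :=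
  Equiv.ofBijective (fun x => digits p x.1 x.2)
    ((Fintype.bijective_iff_injective_and_card _).2 ⟨digits_injective, by
      rw [Fintype.card_prod, ZMod.card, ZMod.card, pow_two]⟩)

theorem exists_digits {p : ℕ} [NeZero p] (x : ZMod (p ^ 2)) : ∃ a t, digits p a t = x := by
  obtain ⟨⟨a, t⟩, h⟩ := (digitsEquiv p).surjective x
  exact ⟨a, t, h⟩

theorem sum_eq_sum_digits {p : ℕ} [NeZero p] {M : Type*} [AddCommMonoid M]
    (F : ZMod (p ^ 2) → M) : ∑ x, F x = ∑ a, ∑ t, F (digits p a t) := by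
  rw [← (digitsEquiv p).sum_comp, Fintype.sum_prod_type]
  rfl

/-- The restriction of `f` to the coset `a + pℤ/p²ℤ`. -/
def slice {p : ℕ} (f : ZMod (p ^ 2) → ℂ) (a : ZMod p) : ZMod p → ℂ := fun t => f (digits p a t)

theorem ncard_support_eq_sum {N : ℕ} [NeZero N] (f : ZMod N → ℂ) :
    (Function.support f).ncard = ∑ x, Set.indicator (Function.support f) 1 x := by
  classical
  rw [Set.ncard_eq_toFinset_card', Finset.card_eq_sum_ones]
  simp [Set.indicator_apply, Finset.sum_ite]

theorem ncard_support_eq_sum_slice {p : ℕ} [NeZero p] (f : ZMod (p ^ 2) → ℂ) :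
    (Function.support f).ncard = ∑ a, (Function.support (slice f a)).ncard := by
  rw [ncard_support_eq_sum, sum_eq_sum_digits]
  refine Finset.sum_congr rfl fun a _ => ?_
  rw [ncard_support_eq_sum]
  rfl

theorem stdAddChar_natCast_mul_natCast_val {p : ℕ} [NeZero p] (a : ZMod p) (y : ZMod (p ^ 2)) :
    ZMod.stdAddChar (-((p : ZMod (p ^ 2)) * ((a.val : ℕ) : ZMod (p ^ 2)) * y)) =
      ZMod.stdAddChar (-(a * redMod p y)) := by
  rw [mul_assoc, ← mul_neg, stdAddChar_natCast_mul]
  simp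

/-- The Cooley–Tukey factorization: in the product of `p t + a` and `p s + b` the term `p² t s`
disappears, leaving a transform in `t`, a twist by `a b`, and a transform in `a`. -/
theorem slice_dft {p : ℕ} [NeZero p] (f : ZMod (p ^ 2) → ℂ) (b : ZMod p) :
    slice (ZMod.dft f) b = ZMod.dft fun a : ZMod p =>
      ZMod.stdAddChar (-(((a.val : ℕ) : ZMod (p ^ 2)) * ((b.val : ℕ) : ZMod (p ^ 2)))) *
        ZMod.dft (slice f a) b := by
  funext s
  simp only [slice, ZMod.dft_apply, smul_eq_mul, Finset.mul_sum]
  rw [sum_eq_sum_digits]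
  refine Finset.sum_congr rfl fun a _ => Finset.sum_congr rfl fun t _ => ?_
  have hpp : (p : ZMod (p ^ 2)) * (p : ZMod (p ^ 2)) = 0 := by
    rw [← pow_two, ← Nat.cast_pow, ZMod.natCast_self]
  have h : -(digits p a t * digits p b s) =
      -((p : ZMod (p ^ 2)) * ((s.val : ℕ) : ZMod (p ^ 2)) * ((a.val : ℕ) : ZMod (p ^ 2))) +
      (-(((a.val : ℕ) : ZMod (p ^ 2)) * ((b.val : ℕ) : ZMod (p ^ 2))) +
      -((p : ZMod (p ^ 2)) * ((t.val : ℕ) : ZMod (p ^ 2)) * ((b.val : ℕ) : ZMod (p ^ 2)))) := by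
    simp only [digits]
    linear_combination (-((t.val : ℕ) : ZMod (p ^ 2)) * ((s.val : ℕ) : ZMod (p ^ 2))) * hpp
  rw [h, AddChar.map_add_eq_mul, AddChar.map_add_eq_mul, stdAddChar_natCast_mul_natCast_val,
    stdAddChar_natCast_mul_natCast_val, redMod_val_cast, redMod_val_cast, mul_comm s]
  ring

open Classical in
/-- The cosets of `pℤ/p²ℤ` met by the support of `f`. -/
noncomputable def cosetSupport {p : ℕ} [NeZero p] (f : ZMod (p ^ 2) → ℂ) : Finset (ZMod p) :=
  {a | slice f a ≠ 0}

theorem mem_cosetSupport {p : ℕ} [NeZero p] {f : ZMod (p ^ 2) → ℂ} {a : ZMod p} :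
    a ∈ cosetSupport f ↔ slice f a ≠ 0 := by
  simp [cosetSupport]

theorem redMod_mem_cosetSupport {p : ℕ} [NeZero p] {f : ZMod (p ^ 2) → ℂ} {x : ZMod (p ^ 2)}
    (hx : f x ≠ 0) : redMod p x ∈ cosetSupport f := by
  obtain ⟨a, t, rfl⟩ := exists_digits x
  rw [redMod_digits, mem_cosetSupport]
  exact fun h => hx (congr_fun h t)

theorem coe_cosetSupport {p : ℕ} [NeZero p] (f : ZMod (p ^ 2) → ℂ) :
    (cosetSupport f : Set (ZMod p)) = redMod p '' Function.support f := by
  ext a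
  constructor
  · intro h
    obtain ⟨t, ht⟩ := Function.ne_iff.1 (mem_cosetSupport.1 h)
    exact ⟨_, ht, redMod_digits a t⟩
  · rintro ⟨x, hx, rfl⟩
    exact redMod_mem_cosetSupport hx

theorem injOn_redMod_of_ncard_le {p : ℕ} [NeZero p] {f : ZMod (p ^ 2) → ℂ}
    (h : (Function.support f).ncard ≤ (cosetSupport f).card) :
    Set.InjOn (redMod p) (Function.support f) := by
  refine Set.injOn_of_ncard_image_eq (le_antisymm (Set.ncard_image_le) ?_)
  rwa [← coe_cosetSupport, Set.ncard_coe_finset]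

theorem cosetSupport_nonempty {p : ℕ} [NeZero p] {f : ZMod (p ^ 2) → ℂ} (hf : f ≠ 0) :
    (cosetSupport f).Nonempty := by
  obtain ⟨x, hx⟩ := Function.ne_iff.1 hf
  exact ⟨_, redMod_mem_cosetSupport hx⟩

theorem card_cosetSupport_le {p : ℕ} [NeZero p] (f : ZMod (p ^ 2) → ℂ) :
    (cosetSupport f).card ≤ p := by
  simpa using (cosetSupport f).card_le_univ

theorem ncard_support_eq_sum_cosetSupport {p : ℕ} [NeZero p] (f : ZMod (p ^ 2) → ℂ) :
    (Function.support f).ncard = ∑ a ∈ cosetSupport f, (Function.support (slice f a)).ncard := by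
  rw [ncard_support_eq_sum_slice]
  refine (Finset.sum_subset (Finset.subset_univ _) fun a _ ha => ?_).symm
  rw [mem_cosetSupport, not_not] at ha
  simp [ha]

/-! ### Counting by cosets. -/

/-- Uncertainty for the inner transform: wherever the transform of the slice at `a` is nonzero at
`b`, the outer transform at `b` has a nonzero input. -/
theorem lt_ncard_slice_add_card_cosetSupport_dft {p : ℕ} [Fact p.Prime] {f : ZMod (p ^ 2) → ℂ}
    {a : ZMod p} (ha : a ∈ cosetSupport f) :
    p + 1 ≤ (Function.support (slice f a)).ncard + (cosetSupport (ZMod.dft f)).card := by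
  refine (ZMod.lt_ncard_support_add_ncard_support_dft (mem_cosetSupport.1 ha)).trans ?_
  rw [← Set.ncard_coe_finset]
  refine Nat.add_le_add_left (Set.ncard_le_ncard fun b hb => ?_) _
  rw [Finset.mem_coe, mem_cosetSupport, slice_dft]
  rw [Ne, LinearEquiv.map_eq_zero_iff]
  exact fun h => mul_ne_zero (ZMod.addChar_apply_ne_zero _ _) hb (congr_fun h a)

/-- Uncertainty for the outer transform, whose input is supported on the cosets met by `f`. -/
theorem lt_card_cosetSupport_add_ncard_slice_dft {p : ℕ} [Fact p.Prime] {f : ZMod (p ^ 2) → ℂ}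
    {b : ZMod p} (hb : b ∈ cosetSupport (ZMod.dft f)) :
    p + 1 ≤ (cosetSupport f).card + (Function.support (slice (ZMod.dft f) b)).ncard := by
  rw [mem_cosetSupport, slice_dft, Ne, LinearEquiv.map_eq_zero_iff] at hb
  rw [slice_dft]
  refine (ZMod.lt_ncard_support_add_ncard_support_dft hb).trans ?_
  rw [← Set.ncard_coe_finset]
  refine Nat.add_le_add_right (Set.ncard_le_ncard fun a ha => ?_) _
  rw [Finset.mem_coe, mem_cosetSupport]
  intro h
  apply ha
  simp [h]

/-- The basic count: `s` is the least number of points of the support on a coset that it meets. -/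
theorem exists_slice_counts {p : ℕ} [Fact p.Prime] {f : ZMod (p ^ 2) → ℂ} (hf : f ≠ 0) :
    ∃ a ∈ cosetSupport f, (∀ a' ∈ cosetSupport f,
        (Function.support (slice f a)).ncard ≤ (Function.support (slice f a')).ncard) ∧
      (cosetSupport f).card * (Function.support (slice f a)).ncard ≤ (Function.support f).ncard ∧
      (cosetSupport (ZMod.dft f)).card * (p + 1 - (cosetSupport f).card) ≤
        (Function.support (ZMod.dft f)).ncard ∧
      1 ≤ (Function.support (slice f a)).ncard ∧ (Function.support (slice f a)).ncard ≤ p := by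
  obtain ⟨a, ha, hmin⟩ := Finset.exists_min_image (cosetSupport f)
    (fun a => (Function.support (slice f a)).ncard) (cosetSupport_nonempty hf)
  refine ⟨a, ha, hmin, ?_, ?_, ?_, ?_⟩
  · rw [ncard_support_eq_sum_cosetSupport, ← smul_eq_mul]
    exact Finset.card_nsmul_le_sum _ _ _ hmin
  · rw [ncard_support_eq_sum_cosetSupport, ← smul_eq_mul]
    refine Finset.card_nsmul_le_sum _ _ _ fun b hb => ?_
    have := lt_card_cosetSupport_add_ncard_slice_dft hb
    omega
  · rw [Nat.one_le_iff_ne_zero, Ne, Set.ncard_eq_zero, Function.support_eq_empty_iff]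
    exact mem_cosetSupport.1 ha
  · simpa using Set.ncard_le_ncard (Set.subset_univ (Function.support (slice f a)))

/-! ### Characters and the extremal families. -/

theorem ZMod.exists_addChar_eq {N : ℕ} [NeZero N] (χ : AddChar (ZMod N) ℂ) :
    ∃ b : ZMod N, ∀ x, χ x = ZMod.stdAddChar (b * x) := by
  have hinj := AddChar.to_mulShift_inj_of_isPrimitive (ZMod.isPrimitive_stdAddChar N)
  have hbij := (Fintype.bijective_iff_injective_and_card
    (AddChar.mulShift (ZMod.stdAddChar (N := N)))).2 ⟨hinj, AddChar.card_eq.symm⟩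
  obtain ⟨b, rfl⟩ := hbij.2 χ
  exact ⟨b, fun x => by rw [AddChar.mulShift_apply]⟩

theorem ZMod.dft_const_apply {N : ℕ} [NeZero N] (c : ℂ) (b : ZMod N) :
    ZMod.dft (fun _ => c) b = if b = 0 then N * c else 0 := by
  have h := AddChar.sum_mulShift (-b) (ZMod.isPrimitive_stdAddChar N)
  simp only [ZMod.dft_apply, smul_eq_mul]
  rw [← Finset.sum_mul]
  simp only [mul_neg, neg_eq_zero, ZMod.card] at h
  rw [h]
  split_ifs <;> simp

/-- The function equal to `g` on the coset `a + pℤ/p²ℤ` and zero elsewhere. -/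
noncomputable def onCoset {p : ℕ} [NeZero p] (a : ZMod p) (g : ZMod p → ℂ) : ZMod (p ^ 2) → ℂ :=
  fun x => if ((digitsEquiv p).symm x).1 = a then g ((digitsEquiv p).symm x).2 else 0

theorem onCoset_digits {p : ℕ} [NeZero p] (a : ZMod p) (g : ZMod p → ℂ) (a' t : ZMod p) :
    onCoset a g (digits p a' t) = if a' = a then g t else 0 := by
  have : (digitsEquiv p).symm (digits p a' t) = (a', t) := (digitsEquiv p).symm_apply_apply (a', t)
  simp [onCoset, this]

theorem ncard_support_of_slice {p : ℕ} [NeZero p] {a : ZMod p} {g : ZMod p → ℂ}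
    {f : ZMod (p ^ 2) → ℂ} (hf : ∀ a' t, f (digits p a' t) = if a' = a then g t else 0) :
    (Function.support f).ncard = (Function.support g).ncard := by
  rw [ncard_support_eq_sum_slice, Finset.sum_eq_single a]
  · congr 2
    funext t
    simp [slice, hf]
  · intro a' _ h
    have : slice f a' = 0 := by
      funext t
      simp [slice, hf, h]
    simp [this]
  · simp

theorem ncard_support_dft_of_slice {p : ℕ} [NeZero p] {a : ZMod p} {g : ZMod p → ℂ}
    {f : ZMod (p ^ 2) → ℂ} (hf : ∀ a' t, f (digits p a' t) = if a' = a then g t else 0) :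
    (Function.support (ZMod.dft f)).ncard = p * (Function.support (ZMod.dft g)).ncard := by
  have hs : slice f a = g := by
    funext t
    simp [slice, hf]
  have hs0 : ∀ a' ≠ a, slice f a' = 0 := fun a' h => by
    funext t
    simp [slice, hf, h]
  have hd : ∀ b s, slice (ZMod.dft f) b s = ZMod.stdAddChar (-(a * s)) *
      (ZMod.stdAddChar (-(((a.val : ℕ) : ZMod (p ^ 2)) * ((b.val : ℕ) : ZMod (p ^ 2)))) *
        ZMod.dft g b) := by
    intro b s
    rw [slice_dft, ZMod.dft_apply, Finset.sum_eq_single a]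
    · rw [hs, smul_eq_mul]
    · intro a' _ h
      simp [hs0 a' h]
    · simp
  have hb : ∀ b, (Function.support (slice (ZMod.dft f) b)).ncard =
      p * Set.indicator (Function.support (ZMod.dft g)) 1 b := by
    intro b
    by_cases h : ZMod.dft g b = 0
    · have : slice (ZMod.dft f) b = 0 := by
        funext s
        simp [hd, h]
      simp [this, h]
    · have : Function.support (slice (ZMod.dft f) b) = Set.univ := by
        ext s
        simp [hd, h, ZMod.addChar_apply_ne_zero]
      simp [this, h]
  rw [ncard_support_eq_sum_slice, ncard_support_eq_sum, Finset.mul_sum]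
  exact Finset.sum_congr rfl fun b _ => hb b

theorem ncard_support_comp_redMod {p : ℕ} [NeZero p] (g : ZMod p → ℂ) :
    (Function.support fun x => g (redMod p x)).ncard = p * (Function.support g).ncard := by
  rw [ncard_support_eq_sum_slice, ncard_support_eq_sum g, Finset.mul_sum]
  refine Finset.sum_congr rfl fun a _ => ?_
  by_cases h : g a = 0
  · have : slice (fun x => g (redMod p x)) a = 0 := by
      funext t
      simp [slice, redMod_digits, h]
    simp [this, h]
  · have : Function.support (slice (fun x => g (redMod p x)) a) = Set.univ := by
      ext t
      simp [slice, redMod_digits, h]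
    simp [this, h]

theorem ncard_support_dft_comp_redMod {p : ℕ} [NeZero p] (g : ZMod p → ℂ) :
    (Function.support (ZMod.dft fun x => g (redMod p x))).ncard =
      (Function.support (ZMod.dft g)).ncard := by
  have hp : (p : ℂ) ≠ 0 := NeZero.ne _
  have hs : ∀ a, slice (fun x => g (redMod p x)) a = fun _ => g a := fun a => by
    funext t
    simp [slice, redMod_digits]
  rw [ncard_support_eq_sum_slice, Finset.sum_eq_single 0]
  · have : slice (ZMod.dft fun x => g (redMod p x)) 0 = (p : ℂ) • ZMod.dft g := by
      rw [slice_dft, ← map_smul]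
      congr 1
      funext a
      simp [hs, ZMod.dft_const_apply]
    rw [this, Function.support_const_smul_of_ne_zero _ _ hp]
  · intro b _ hb
    have : slice (ZMod.dft fun x => g (redMod p x)) b = 0 := by
      rw [slice_dft, LinearEquiv.map_eq_zero_iff]
      funext a
      simp [hs, ZMod.dft_const_apply, hb]
    simp [this]
  · simp

theorem ncard_support_stdAddChar_mul {N : ℕ} [NeZero N] (b : ZMod N) (f : ZMod N → ℂ) :
    (Function.support fun x => ZMod.stdAddChar (b * x) * f x).ncard =
      (Function.support f).ncard := by
  congr 1
  ext x
  simp [ZMod.addChar_apply_ne_zero]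

theorem ncard_support_dft_stdAddChar_mul {N : ℕ} [NeZero N] (b : ZMod N) (f : ZMod N → ℂ) :
    (Function.support (ZMod.dft fun x => ZMod.stdAddChar (b * x) * f x)).ncard =
      (Function.support (ZMod.dft f)).ncard := by
  have : (Function.support (ZMod.dft fun x => ZMod.stdAddChar (b * x) * f x)) =
      (Equiv.subRight b) ⁻¹' (Function.support (ZMod.dft f)) := by
    ext x
    simp [ZMod.dft_stdAddChar_mul]
  rw [this, Set.ncard_preimage_of_injective_subset_range (Equiv.injective _) (by simp)]

theorem natCast_mul_eq_zero_of_redMod {p : ℕ} [NeZero p] {y : ZMod (p ^ 2)} (h : redMod p y = 0) :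
    (p : ZMod (p ^ 2)) * y = 0 := by
  rw [← redMod_natCast_val, ZMod.natCast_eq_zero_iff] at h
  rw [← ZMod.natCast_zmod_val y, ← Nat.cast_mul, ZMod.natCast_eq_zero_iff]
  exact (dvd_of_eq (pow_two p)).trans (Nat.mul_dvd_mul_left p h)

/-- A function with spectrum in one coset is a character times a function of the residue. -/
theorem eq_stdAddChar_mul_of_cosetSupport_dft {p : ℕ} [NeZero p] {f : ZMod (p ^ 2) → ℂ}
    {b : ZMod p} (h : cosetSupport (ZMod.dft f) ⊆ {b}) :
    ∃ g : ZMod p → ℂ, ∀ x, f x =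
      ZMod.stdAddChar (((b.val : ℕ) : ZMod (p ^ 2)) * x) * g (redMod p x) := by
  set β : ZMod (p ^ 2) := ((b.val : ℕ) : ZMod (p ^ 2)) with hβ
  -- By Fourier inversion: every frequency `y` is congruent to `β` mod `p`, so translation by `p t`
  -- multiplies all terms by the same phase.
  have hshift : ∀ x t : ZMod (p ^ 2),
      f (x + (p : ZMod (p ^ 2)) * t) =
        ZMod.stdAddChar (β * ((p : ZMod (p ^ 2)) * t)) * f x := by
    intro x t
    rw [← ZMod.dft.symm_apply_apply f, ZMod.invDFT_apply, ZMod.invDFT_apply, mul_smul_comm,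
      Finset.mul_sum]
    refine congr_arg _ (Finset.sum_congr rfl fun y _ => ?_)
    by_cases hy : ZMod.dft f y = 0
    · simp [hy]
    · have h1 : redMod p (y - β) = 0 := by
        rw [map_sub, hβ, redMod_val_cast, sub_eq_zero]
        exact Finset.mem_singleton.1 (h (redMod_mem_cosetSupport hy))
      have h2 := natCast_mul_eq_zero_of_redMod h1
      rw [smul_eq_mul, smul_eq_mul, ← mul_assoc, ← AddChar.map_add_eq_mul]
      congr 2
      linear_combination t * h2
  refine ⟨fun a => ZMod.stdAddChar (-(β * ((a.val : ℕ) : ZMod (p ^ 2)))) *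
    f ((a.val : ℕ) : ZMod (p ^ 2)), fun x => ?_⟩
  obtain ⟨a, t, rfl⟩ := exists_digits x
  rw [redMod_digits, digits, add_comm, hshift]
  dsimp only
  rw [← mul_assoc (ZMod.stdAddChar _), ← AddChar.map_add_eq_mul]
  congr 2
  ring

/-! ### Lower bounds for the spectrum. -/

theorem meshulam_eq_of {N : ℕ} [NeZero N] {k v : ℕ}
    (hlow : ∀ f : ZMod N → ℂ, f ≠ 0 → (Function.support f).ncard ≤ k →
      v ≤ (Function.support (ZMod.dft f)).ncard)
    (hex : ∃ f : ZMod N → ℂ, f ≠ 0 ∧ (Function.support f).ncard ≤ k ∧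
      (Function.support (ZMod.dft f)).ncard = v) : meshulam N k = v := by
  obtain ⟨f, hf, hfk, hfv⟩ := hex
  refine le_antisymm (Nat.sInf_le ⟨f, ⟨hfk, hfv⟩, hf⟩) ?_
  refine le_csInf ⟨v, f, ⟨hfk, hfv⟩, hf⟩ ?_
  rintro l ⟨f', ⟨h1, h2⟩, h3⟩
  exact h2 ▸ hlow f' h3 h1

theorem ne_zero_of_ncard_support {N : ℕ} {f : ZMod N → ℂ}
    (h : 1 ≤ (Function.support f).ncard) : f ≠ 0 := by
  rintro rfl
  simp at h

/-- The spectrum has at least `(p + 1 - s)(p + 1 - m) = p (p + 1 - m s) + (p + 1)(m - 1)(s - 1)`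
points, and `m s ≤ k`. -/
theorem mul_le_ncard_support_dft {p : ℕ} [Fact p.Prime] {k : ℕ} (hk : k ≤ p)
    {f : ZMod (p ^ 2) → ℂ} (hf : f ≠ 0) (hfk : (Function.support f).ncard ≤ k) :
    p * (p - k + 1) ≤ (Function.support (ZMod.dft f)).ncard := by
  obtain ⟨a, ha, -, hms, hN, hs1, hsp⟩ := exists_slice_counts hf
  have hn := lt_ncard_slice_add_card_cosetSupport_dft ha
  have hm1 := Finset.card_pos.2 (cosetSupport_nonempty hf)
  have hmp := card_cosetSupport_le f
  generalize (cosetSupport f).card = m at *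
  generalize (cosetSupport (ZMod.dft f)).card = n at *
  generalize (Function.support (slice f a)).ncard = s at *
  zify [hk, show m ≤ p + 1 by omega] at *
  nlinarith [mul_nonneg (show (0 : ℤ) ≤ m - 1 by omega) (show (0 : ℤ) ≤ s - 1 by omega),
    mul_nonneg (show (0 : ℤ) ≤ n - (p + 1 - s) by omega) (show (0 : ℤ) ≤ p + 1 - m by omega),
    mul_nonneg (show (0 : ℤ) ≤ p by omega) (show (0 : ℤ) ≤ k - m * s by omega),
    mul_nonneg (show (0 : ℤ) ≤ p + 1 by omega) (mul_nonneg (show (0 : ℤ) ≤ m - 1 by omega)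
      (show (0 : ℤ) ≤ s - 1 by omega))]

/-- With `u = p - m` and `v = p - s`, the spectrum has at least `(u + 1)(v + 1) ≥ u + v + 1` points,
while `(p - u)(p - v) ≤ k < p (k / p + 1)` forces `u + v ≥ p - k / p`. -/
theorem le_ncard_support_dft {p : ℕ} [Fact p.Prime] {k : ℕ}
    {f : ZMod (p ^ 2) → ℂ} (hf : f ≠ 0) (hfk : (Function.support f).ncard ≤ k) :
    p - k / p + 1 ≤ (Function.support (ZMod.dft f)).ncard := by
  obtain ⟨a, ha, -, hms, hN, hs1, hsp⟩ := exists_slice_counts hf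
  have hn := lt_ncard_slice_add_card_cosetSupport_dft ha
  have hm1 := Finset.card_pos.2 (cosetSupport_nonempty hf)
  have hmp := card_cosetSupport_le f
  have hlt : k < p * (k / p + 1) := Nat.lt_mul_div_succ k (NeZero.pos p)
  generalize (cosetSupport f).card = m at *
  generalize (cosetSupport (ZMod.dft f)).card = n at *
  generalize (Function.support (slice f a)).ncard = s at *
  generalize k / p = r at *
  obtain ⟨u, rfl⟩ := Nat.exists_eq_add_of_le hmp
  obtain ⟨v, hv⟩ := Nat.exists_eq_add_of_le hsp
  rw [show m + u + 1 - m = u + 1 by omega] at hN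
  have h1 : m + u - r ≤ u + v := by
    by_contra! h
    have : (m + u) * (r + 1 + (u + v)) ≤ (m + u) * (m + u) := Nat.mul_le_mul_left _ (by omega)
    nlinarith
  have : (v + 1) * (u + 1) ≤ n * (u + 1) := Nat.mul_le_mul_right _ (by omega)
  nlinarith

/-! ### Structure of the equality cases. -/

theorem exists_card_eq_of_ncard_slice_le {p : ℕ} [NeZero p] {f : ZMod (p ^ 2) → ℂ}
    {a : ZMod p} {l : ℕ} (h : (Function.support (slice f a)).ncard + l ≤ p) :
    ∃ T : Finset (ZMod p), T.card = l ∧ ∀ t ∈ T, f (digits p a t) = 0 := by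
  classical
  obtain ⟨T, hT, hTl⟩ := Finset.exists_subset_card_eq
    (s := (Function.support (slice f a)).toFinsetᶜ) (n := l) (by
      rw [Finset.card_compl, ZMod.card, ← Set.ncard_eq_toFinset_card']
      omega)
  exact ⟨T, hTl, fun t ht => by simpa [slice] using hT ht⟩

theorem eq_ite_of_cosetSupport_subset {p : ℕ} [NeZero p] {f : ZMod (p ^ 2) → ℂ}
    {a : ZMod p} (h : cosetSupport f ⊆ {a}) (a' t : ZMod p) :
    f (digits p a' t) = if a' = a then slice f a t else 0 := by
  split_ifs with h'
  · rw [h']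
    rfl
  · by_contra h0
    have := h (redMod_mem_cosetSupport h0)
    rw [redMod_digits] at this
    exact h' (Finset.mem_singleton.1 this)

/-- Equality in the count forces `m s = k` and `(m - 1)(s - 1) = 0`. If `m ≠ 1`, then `s = 1` and
the transform has `k - 1 ≥ 1` zeros on every coset, the maximal number, against rigidity. -/
theorem exists_cosetSupport_subset_of_low {p : ℕ} [Fact p.Prime] {k : ℕ} (hk1 : 1 ≤ k)
    (hk : k ≤ p) {f : ZMod (p ^ 2) → ℂ} (hfk : (Function.support f).ncard = k)
    (hfN : (Function.support (ZMod.dft f)).ncard = p * (p - k + 1)) :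
    ∃ a, cosetSupport f ⊆ {a} := by
  have hp2 := (Fact.out : p.Prime).two_le
  have hf : f ≠ 0 := ne_zero_of_ncard_support (hfk ▸ hk1)
  obtain ⟨a, ha, -, hms, hN, hs1, hsp⟩ := exists_slice_counts hf
  have hn := lt_ncard_slice_add_card_cosetSupport_dft ha
  have hm1 := Finset.card_pos.2 (cosetSupport_nonempty hf)
  have hmp := card_cosetSupport_le f
  have hnp := card_cosetSupport_le (ZMod.dft f)
  rw [hfk] at hms
  rw [hfN] at hN
  have hcases : (cosetSupport f).card = 1 ∨
      ((Function.support (slice f a)).ncard = 1 ∧ (cosetSupport f).card = k) := by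
    generalize (cosetSupport f).card = m at *
    generalize (cosetSupport (ZMod.dft f)).card = n at *
    generalize (Function.support (slice f a)).ncard = s at *
    zify [hk, show m ≤ p + 1 by omega] at *
    have e1 : (0 : ℤ) ≤ ((m : ℤ) - 1) * (s - 1) :=
      mul_nonneg (by omega) (by omega)
    have e2 : (0 : ℤ) ≤ (p : ℤ) * (k - m * s) := mul_nonneg (by omega) (by omega)
    have e3 : (0 : ℤ) ≤ (n - (p + 1 - s)) * ((p : ℤ) + 1 - m) :=
      mul_nonneg (by omega) (by omega)
    have e4 : (p : ℤ) * (k - m * s) + (p + 1) * (((m : ℤ) - 1) * (s - 1)) ≤ 0 := by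
      linarith
    have e5 : (0 : ℤ) ≤ (p + 1) * (((m : ℤ) - 1) * (s - 1)) := mul_nonneg (by omega) e1
    have e6 : (p : ℤ) * (k - m * s) = 0 := by linarith
    have e7 : (p + 1 : ℤ) * (((m : ℤ) - 1) * (s - 1)) = 0 := by linarith
    have e8 : (k : ℤ) - m * s = 0 := by
      rcases mul_eq_zero.1 e6 with h | h
      · omega
      · exact h
    rcases mul_eq_zero.1 e7 with h | h
    · omega
    · rcases mul_eq_zero.1 h with h | h
      · left; omega
      · right
        have hs : (s : ℤ) = 1 := by omega
        rw [hs] at e8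
        exact ⟨hs, by omega⟩
  by_cases hm : (cosetSupport f).card = 1
  · obtain ⟨a, ha⟩ := Finset.card_eq_one.1 hm
    exact ⟨a, ha.subset⟩
  obtain ⟨hs, hmk⟩ := hcases.resolve_left hm
  exfalso
  have hinj := injOn_redMod_of_ncard_le (f := f) (by omega)
  have huniv : cosetSupport (ZMod.dft f) = Finset.univ := by
    rw [← Finset.card_eq_iff_eq_univ, ZMod.card]
    omega
  have hge : ∀ b ∈ Finset.univ, p - k + 1 ≤ (Function.support (slice (ZMod.dft f) b)).ncard := by
    intro b hb
    have := lt_card_cosetSupport_add_ncard_slice_dft (f := f) (b := b) (huniv ▸ hb)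
    omega
  have heq := (Finset.sum_eq_sum_iff_of_le hge).1 (by
    rw [← ncard_support_eq_sum_slice, hfN, Finset.sum_const, Finset.card_univ, ZMod.card,
      smul_eq_mul])
  have hzero : ∀ b : ZMod p, ∃ T : Finset (ZMod p), T.card = k - 1 ∧
      ∀ t ∈ T, ZMod.dft f (digits p b t) = 0 := fun b =>
    exists_card_eq_of_ncard_slice_le (by rw [← heq b (Finset.mem_univ b)]; omega)
  obtain ⟨T₀, hT₀, hT₀z⟩ := hzero 0
  obtain ⟨T₁, hT₁, hT₁z⟩ := hzero 1
  obtain ⟨t, ht⟩ := Finset.card_pos.1 (show 0 < T₁.card by omega)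
  have := redMod_eq_of_dft_eq_zero hinj hf (T := T₀) (by omega) hT₀z (hT₁z t ht)
  rw [redMod_digits, redMod_val_cast] at this
  exact one_ne_zero this

theorem natCast_mul_val_neg_add {p : ℕ} [NeZero p] (a t : ZMod p) :
    (p : ZMod (p ^ 2)) * (((-t).val : ℕ) : ZMod (p ^ 2)) + -((a.val : ℕ) : ZMod (p ^ 2)) =
      -digits p a t := by
  have :
      (p : ZMod (p ^ 2)) * ((((-t).val : ℕ) : ZMod (p ^ 2)) + ((t.val : ℕ) : ZMod (p ^ 2))) = 0 := by
    apply natCast_mul_eq_zero_of_redMod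
    rw [map_add, redMod_val_cast, redMod_val_cast, neg_add_cancel]
  rw [digits]
  linear_combination this

/-- The dual form of `redMod_eq_of_dft_eq_zero`. -/
theorem redMod_eq_of_eq_zero {p : ℕ} [Fact p.Prime] {f : ZMod (p ^ 2) → ℂ}
    (hinj : Set.InjOn (redMod p) (Function.support (ZMod.dft f))) (hf : f ≠ 0)
    {T : Finset (ZMod p)} (hT : (Function.support (ZMod.dft f)).ncard ≤ T.card + 1) {a : ZMod p}
    (h0 : ∀ t ∈ T, f (digits p a t) = 0) {x : ZMod (p ^ 2)} (hx : f x = 0) : redMod p x = a := by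
  classical
  -- Applying the transform twice gives a multiple of the reflection of `f`, hence the negated
  -- zeros.
  have := redMod_eq_of_dft_eq_zero hinj (by rwa [Ne, LinearEquiv.map_eq_zero_iff])
    (T := T.image Neg.neg) (x₀ := -((a.val : ℕ) : ZMod (p ^ 2))) (x := -x)
    (by rwa [Finset.card_image_of_injective _ neg_injective])
    (by
      intro t' ht'
      obtain ⟨t, ht, rfl⟩ := Finset.mem_image.1 ht'
      rw [natCast_mul_val_neg_add, ZMod.dft_dft]
      dsimp only
      rw [neg_neg, h0 t ht, smul_zero])
    (by
      rw [ZMod.dft_dft]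
      dsimp only
      rw [neg_neg, hx, smul_zero])
  rwa [map_neg (redMod p), map_neg (redMod p), neg_inj, redMod_val_cast] at this

/-- If the spectrum meets at least two cosets, equality in the count forces `u = p - m = 0` and one
spectral point per coset met. By dual rigidity all zeros of `f` lie on a single coset, so `k = s +
(p - 1) p`; comparing sizes gives `s = p - 1`. -/
theorem cosetSupport_dft_or_injOn_of_high {p : ℕ} [Fact p.Prime] {k : ℕ} (hk : p ≤ k)
    (hkp : k ≤ p ^ 2) {f : ZMod (p ^ 2) → ℂ} (hfk : (Function.support f).ncard = k)
    (hfN : (Function.support (ZMod.dft f)).ncard = p - k / p + 1) :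
    (∃ b, cosetSupport (ZMod.dft f) ⊆ {b}) ∨
      (k = p ^ 2 - 1 ∧ Set.InjOn (redMod p) (Function.support (ZMod.dft f))) := by
  have hp2 := (Fact.out : p.Prime).two_le
  have hf : f ≠ 0 := ne_zero_of_ncard_support (by omega)
  obtain ⟨a, ha, -, hms, hN, hs1, hsp⟩ := exists_slice_counts hf
  have hn := lt_ncard_slice_add_card_cosetSupport_dft ha
  have hmp := card_cosetSupport_le f
  have hlt : k < p * (k / p + 1) := Nat.lt_mul_div_succ k (NeZero.pos p)
  rw [hfk] at hms
  rw [hfN] at hN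
  by_cases hn1 : (cosetSupport (ZMod.dft f)).card ≤ 1
  · left
    obtain ⟨b, hb⟩ := Finset.card_le_one_iff_subset_singleton.1 hn1
    exact ⟨b, hb⟩
  right
  obtain ⟨v, hv⟩ := Nat.exists_eq_add_of_le hsp
  have hcount : p - k / p + 1 ≤ v + 1 ∧ (cosetSupport f).card = p := by
    generalize (cosetSupport f).card = m at *
    generalize (cosetSupport (ZMod.dft f)).card = n at *
    generalize (Function.support (slice f a)).ncard = s at *
    generalize k / p = r at *
    obtain ⟨u, hu⟩ := Nat.exists_eq_add_of_le hmp
    rw [show p + 1 - m = u + 1 by omega] at hN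
    have h1 : p - r ≤ u + v := by
      by_contra! h
      have e : p * (r + 1 + (u + v)) ≤ p * p := Nat.mul_le_mul_left _ (by omega)
      have e2 : (m + u) * (s + v) = p * p := by rw [← hu, ← hv]
      nlinarith
    have h2 : u = 0 := by
      by_contra h
      have e : (2 : ℕ) * u ≤ n * u := Nat.mul_le_mul_right _ (by omega)
      rw [Nat.mul_add, mul_one] at hN
      generalize n * u = w at *
      omega
    omega
  rw [hcount.2, Nat.add_sub_cancel_left, mul_one] at hN
  have hinj := injOn_redMod_of_ncard_le (f := ZMod.dft f) (by omega)
  refine ⟨?_, hinj⟩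
  obtain ⟨T, hT, hTz⟩ := exists_card_eq_of_ncard_slice_le (f := f) (a := a) hv.ge
  have hz : ∀ x, f x = 0 → redMod p x = a := fun x hx =>
    redMod_eq_of_eq_zero hinj hf (T := T) (by omega) hTz hx
  have hsum : (Function.support f).ncard =
      (Function.support (slice f a)).ncard + (p - 1) * p := by
    rw [ncard_support_eq_sum_slice, ← Finset.add_sum_erase _ _ (Finset.mem_univ a)]
    congr 1
    rw [Finset.sum_const_nat (m := p), Finset.card_erase_of_mem (Finset.mem_univ a),
      Finset.card_univ, ZMod.card]
    intro a' ha'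
    have : Function.support (slice f a') = Set.univ := by
      ext t
      simp only [Function.mem_support, Set.mem_univ, iff_true]
      intro h
      have := hz _ h
      rw [redMod_digits] at this
      exact (Finset.mem_erase.1 ha').1 this
    simp [this]
  rw [hfk] at hsum
  generalize (Function.support (slice f a)).ncard = s at *
  obtain ⟨q, rfl⟩ : ∃ q, p = q + 1 := ⟨p - 1, by omega⟩
  rw [Nat.add_sub_cancel] at hsum
  -- Full support would leave a one-point spectrum, which cannot meet two cosets.
  have hs : s < q + 1 := by
    by_contra! h
    have : k / (q + 1) = q + 1 := by
      rw [hsum, Nat.add_mul_div_right _ _ (Nat.succ_pos q), show s = q + 1 by omega,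
        Nat.div_self (Nat.succ_pos q), add_comm]
    omega
  have hdiv : k / (q + 1) = q := by
    rw [hsum, Nat.add_mul_div_right _ _ (Nat.succ_pos q), Nat.div_eq_of_lt hs, zero_add]
  have hsq : s = q := by omega
  rw [hsum, hsq]
  have : (q + 1) ^ 2 = q + q * (q + 1) + 1 := by ring
  omega

/-! ### Explicit values and equality cases. -/

theorem mem_subgroupH_iff {p : ℕ} [NeZero p] {z : ZMod (p ^ 2)} :
    z ∈ subgroupH p ↔ redMod p z = 0 := by
  constructor
  · intro h
    obtain ⟨n, rfl⟩ := AddSubgroup.mem_zmultiples_iff.1 h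
    simp
  · intro h
    obtain ⟨a, t, rfl⟩ := exists_digits z
    rw [redMod_digits] at h
    refine AddSubgroup.mem_zmultiples_iff.2 ⟨(t.val : ℤ), ?_⟩
    simp [digits, h, mul_comm]

theorem deltaSet_cosetH {p : ℕ} [NeZero p] (a z : ZMod (p ^ 2)) :
    deltaSet (cosetH p a) z = if redMod p z = redMod p a then 1 else 0 := by
  have : z ∈ cosetH p a ↔ redMod p z = redMod p a := by
    rw [← sub_eq_zero, ← map_sub, ← mem_subgroupH_iff]
    constructor
    · rintro ⟨h, hh, rfl⟩
      rwa [add_sub_cancel_left]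
    · exact fun h => ⟨z - a, h, (add_sub_cancel a z).symm⟩
  classical
  simp only [deltaSet, Set.indicator_apply, this]

theorem forall_lt_iff_forall_digits {p : ℕ} [NeZero p]
    {P : ZMod (p ^ 2) → ZMod p → ZMod p → Prop} :
    (∀ x x' : ℕ, x < p → x' < p → P ((p * x + x' : ℕ) : ZMod (p ^ 2)) (x' : ZMod p) (x : ZMod p)) ↔
      ∀ a t, P (digits p a t) a t := by
  constructor
  · intro h a t
    have := h t.val a.val (ZMod.val_lt t) (ZMod.val_lt a)
    rwa [← digits_eq_natCast, ZMod.natCast_zmod_val, ZMod.natCast_zmod_val] at this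
  · intro h x x' hx hx'
    have := h (x' : ZMod p) (x : ZMod p)
    rwa [digits_eq_natCast, ZMod.val_natCast_of_lt hx, ZMod.val_natCast_of_lt hx'] at this

theorem meshulam_of_le {p : ℕ} [Fact p.Prime] {k : ℕ} (hk1 : 1 ≤ k) (hk : k ≤ p) :
    meshulam (p ^ 2) k = p * (p - k + 1) := by
  refine meshulam_eq_of (fun f hf hfk => mul_le_ncard_support_dft hk hf hfk) ?_
  obtain ⟨g, hg, hg'⟩ := ZMod.exists_ncard_support_dft_eq hk1 hk
  have h1 := ncard_support_of_slice (onCoset_digits 0 g)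
  have h2 := ncard_support_dft_of_slice (onCoset_digits 0 g)
  rw [hg] at h1
  rw [hg'] at h2
  exact ⟨onCoset 0 g, ne_zero_of_ncard_support (by omega), h1.le, h2⟩

theorem meshulam_of_ge {p : ℕ} [Fact p.Prime] {k : ℕ} (hk : p ≤ k) (hkp : k ≤ p ^ 2) :
    meshulam (p ^ 2) k = p - k / p + 1 := by
  have hp := NeZero.pos p
  refine meshulam_eq_of (fun f hf hfk => le_ncard_support_dft hf hfk) ?_
  obtain ⟨g, hg, hg'⟩ := ZMod.exists_ncard_support_dft_eq (p := p) (r := k / p)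
    (Nat.div_pos hk hp) (Nat.div_le_of_le_mul (by rwa [← pow_two]))
  have h1 := ncard_support_comp_redMod g
  rw [hg] at h1
  refine ⟨fun x => g (redMod p x), ne_zero_of_ncard_support ?_, ?_, ?_⟩
  · rw [h1]
    exact Nat.mul_pos hp (Nat.div_pos hk hp)
  · rw [h1]
    exact Nat.mul_div_le k p
  · rw [ncard_support_dft_comp_redMod, hg']

theorem isEqualityCase_iff {N : ℕ} [NeZero N] {k : ℕ} (hk : 1 ≤ k) {f : ZMod N → ℂ} :
    IsEqualityCase N k f ↔ (Function.support f).ncard = k ∧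
      (Function.support (ZMod.dft f)).ncard = meshulam N k :=
  ⟨fun h => h.2, fun h => ⟨ne_zero_of_ncard_support (h.1 ▸ hk), h⟩⟩

theorem isEqualityCase_low_iff {p : ℕ} [Fact p.Prime] {k : ℕ} (hk1 : 1 ≤ k) (hk : k ≤ p)
    (f : ZMod (p ^ 2) → ℂ) :
    IsEqualityCase (p ^ 2) k f ↔ ∃ (g : ZMod p → ℂ) (a : ZMod p),
      (Function.support g).ncard = k ∧ (Function.support (ZMod.dft g)).ncard = p - k + 1 ∧
      ∀ a' t, f (digits p a' t) = if a' = a then g t else 0 := by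
  rw [isEqualityCase_iff hk1, meshulam_of_le hk1 hk]
  constructor
  · rintro ⟨h1, h2⟩
    obtain ⟨a, ha⟩ := exists_cosetSupport_subset_of_low hk1 hk h1 h2
    have hs := eq_ite_of_cosetSupport_subset ha
    refine ⟨slice f a, a, ?_, ?_, hs⟩
    · rw [← ncard_support_of_slice hs, h1]
    · rw [ncard_support_dft_of_slice hs] at h2
      exact Nat.eq_of_mul_eq_mul_left (NeZero.pos p) h2
  · rintro ⟨g, a, h1, h2, hs⟩
    rw [ncard_support_of_slice hs, ncard_support_dft_of_slice hs, h1, h2]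
    exact ⟨rfl, rfl⟩

theorem ncard_support_of_eq_stdAddChar_mul {p : ℕ} [NeZero p] {f : ZMod (p ^ 2) → ℂ}
    {b : ZMod (p ^ 2)} {g : ZMod p → ℂ}
    (h : ∀ x, f x = ZMod.stdAddChar (b * x) * g (redMod p x)) :
    (Function.support f).ncard = p * (Function.support g).ncard ∧
      (Function.support (ZMod.dft f)).ncard = (Function.support (ZMod.dft g)).ncard := by
  obtain rfl : f = fun x => ZMod.stdAddChar (b * x) * g (redMod p x) := funext h
  rw [ncard_support_stdAddChar_mul b fun x => g (redMod p x),
    ncard_support_dft_stdAddChar_mul b fun x => g (redMod p x)]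
  exact ⟨ncard_support_comp_redMod g, ncard_support_dft_comp_redMod g⟩

theorem not_dvd_sq_sub_one {p : ℕ} (hp : p.Prime) : ¬ p ∣ p ^ 2 - 1 := by
  intro h
  have h1 : p ∣ p ^ 2 := dvd_pow_self p two_ne_zero
  have h2 := (Nat.dvd_sub_iff_right (Nat.one_le_pow _ _ hp.pos) h1).1 h
  exact hp.one_lt.ne' (Nat.dvd_one.1 h2)

theorem isEqualityCase_mul_iff {p : ℕ} [Fact p.Prime] {r : ℕ} (hr1 : 1 ≤ r) (hr : r ≤ p)
    (f : ZMod (p ^ 2) → ℂ) :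
    IsEqualityCase (p ^ 2) (p * r) f ↔ ∃ (b : ZMod (p ^ 2)) (g : ZMod p → ℂ),
      (Function.support g).ncard = r ∧ (Function.support (ZMod.dft g)).ncard = p - r + 1 ∧
      ∀ x, f x = ZMod.stdAddChar (b * x) * g (redMod p x) := by
  have hp := NeZero.pos p
  have h1 : p ≤ p * r := Nat.le_mul_of_pos_right p hr1
  have h2 : p * r ≤ p ^ 2 := by rw [pow_two]; exact Nat.mul_le_mul_left p hr
  rw [isEqualityCase_iff (by omega), meshulam_of_ge h1 h2]
  have hd : p * r / p = r := Nat.mul_div_cancel_left r hp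
  constructor
  · rintro ⟨e1, e2⟩
    rcases cosetSupport_dft_or_injOn_of_high h1 h2 e1 e2 with ⟨b, hb⟩ | ⟨h, -⟩
    · obtain ⟨g, hg⟩ := eq_stdAddChar_mul_of_cosetSupport_dft hb
      obtain ⟨e3, e4⟩ := ncard_support_of_eq_stdAddChar_mul hg
      refine ⟨_, g, ?_, ?_, hg⟩
      · exact Nat.eq_of_mul_eq_mul_left hp (e3.symm.trans e1)
      · rw [← e4, e2, hd]
    · exact absurd (h ▸ dvd_mul_right p r) (not_dvd_sq_sub_one Fact.out)
  · rintro ⟨b, g, e1, e2, hg⟩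
    obtain ⟨e3, e4⟩ := ncard_support_of_eq_stdAddChar_mul hg
    rw [e3, e4, e1, e2, hd]
    exact ⟨rfl, rfl⟩

theorem deltaSet_singleton {G : Type*} [DecidableEq G] (x z : G) :
    deltaSet {x} z = if z = x then 1 else 0 := by
  classical
  simp [deltaSet, Set.indicator_apply]

theorem sub_one_mul_le_sq_sub_one {p : ℕ} (hp : p.Prime) :
    p ≤ p ^ 2 - 1 ∧ (p ^ 2 - 1) / p = p - 1 := by
  obtain ⟨q, rfl⟩ : ∃ q, p = q + 1 := ⟨p - 1, (Nat.sub_add_cancel hp.pos).symm⟩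
  have hq : 1 ≤ q := by have := hp.two_le; omega
  have : (q + 1) ^ 2 - 1 = q + q * (q + 1) := by
    have : (q + 1) ^ 2 = q + q * (q + 1) + 1 := by ring
    omega
  rw [this]
  refine ⟨by nlinarith, ?_⟩
  rw [Nat.add_mul_div_right _ _ (Nat.succ_pos q), Nat.div_eq_of_lt (Nat.lt_succ_self q), zero_add,
    Nat.add_sub_cancel]

theorem meshulam_sq_sub_one {p : ℕ} [hp : Fact p.Prime] : meshulam (p ^ 2) (p ^ 2 - 1) = 2 := by
  obtain ⟨h1, h2⟩ := sub_one_mul_le_sq_sub_one hp.out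
  rw [meshulam_of_ge h1 (Nat.sub_le _ _), h2]
  have := hp.out.two_le
  omega

theorem isEqualityCase_sq_sub_one_iff {p : ℕ} [hp : Fact p.Prime] (f : ZMod (p ^ 2) → ℂ) :
    IsEqualityCase (p ^ 2) (p ^ 2 - 1) f ↔
      ∃ (α : ℂ) (b x y : ZMod (p ^ 2)), α ≠ 0 ∧ redMod p (x - y) ≠ 0 ∧
        ∀ z, ZMod.dft f z = α * ZMod.stdAddChar (b * z) * (deltaSet {x} z - deltaSet {y} z) := by
  classical
  obtain ⟨hp1, hp2⟩ := sub_one_mul_le_sq_sub_one hp.out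
  have hpos := hp.out.two_le
  have hN : (((p ^ 2 : ℕ) : ℂ))⁻¹ ≠ 0 := inv_ne_zero (Nat.cast_ne_zero.2 (NeZero.ne _))
  rw [isEqualityCase_iff (by omega), meshulam_sq_sub_one]
  constructor
  · rintro ⟨e1, e2⟩
    rcases cosetSupport_dft_or_injOn_of_high hp1 (Nat.sub_le _ _) e1 (by
      rw [e2, hp2]; omega) with ⟨b, hb⟩ | ⟨-, hinj⟩
    · obtain ⟨g, hg⟩ := eq_stdAddChar_mul_of_cosetSupport_dft hb
      have h := (ncard_support_of_eq_stdAddChar_mul hg).1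
      rw [e1] at h
      exact absurd ⟨_, h⟩ (not_dvd_sq_sub_one hp.out)
    · obtain ⟨x, y, hxy, hs⟩ := Set.ncard_eq_two.1 e2
      have hx : x ∈ Function.support (ZMod.dft f) := hs ▸ Set.mem_insert x {y}
      have hy : y ∈ Function.support (ZMod.dft f) := hs ▸ Set.mem_insert_of_mem x rfl
      have hother : ∀ z, z ≠ x → z ≠ y → ZMod.dft f z = 0 := by
        intro z hzx hzy
        by_contra h
        have : z ∈ Function.support (ZMod.dft f) := h
        rw [hs] at this
        rcases this with h | h
        · exact hzx h
        · exact hzy h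
      -- Inversion at a zero of `f` ties the two spectral values together: after the phase `-z₀` is
      -- extracted, they are opposite.
      obtain ⟨z₀, hz₀⟩ : ∃ z₀, f z₀ = 0 := by
        by_contra! h
        have : Function.support f = Set.univ := Set.eq_univ_of_forall h
        rw [this, Set.ncard_univ, Nat.card_zmod] at e1
        omega
      have hrel : ZMod.stdAddChar (x * z₀) * ZMod.dft f x +
          ZMod.stdAddChar (y * z₀) * ZMod.dft f y = 0 := by
        have h := hz₀
        rw [← ZMod.dft.symm_apply_apply f, ZMod.invDFT_apply,
          Finset.sum_eq_add x y hxy (fun z _ hz => by rw [hother z hz.1 hz.2, smul_zero])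
            (by simp) (by simp), smul_eq_zero] at h
        exact h.resolve_left hN
      have hinv : ∀ w : ZMod (p ^ 2), ZMod.stdAddChar (w * z₀) * ZMod.stdAddChar (-z₀ * w) = 1 := by
        intro w
        rw [← AddChar.map_add_eq_mul, ← AddChar.map_zero_eq_one (ZMod.stdAddChar (N := p ^ 2))]
        congr 1
        ring
      refine ⟨ZMod.stdAddChar (x * z₀) * ZMod.dft f x, -z₀, x, y,
        mul_ne_zero (ZMod.addChar_apply_ne_zero _ _) hx, ?_, fun z => ?_⟩
      · rw [map_sub, sub_ne_zero]
        exact fun h => hxy (hinj hx hy h)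
      · rw [deltaSet_singleton, deltaSet_singleton]
        by_cases hzx : z = x
        · subst hzx
          rw [if_pos rfl, if_neg hxy]
          linear_combination (-ZMod.dft f z) * hinv z
        · by_cases hzy : z = y
          · subst hzy
            rw [if_neg hzx, if_pos rfl]
            linear_combination (-ZMod.dft f z) * hinv z + ZMod.stdAddChar (-z₀ * z) * hrel
          · rw [if_neg hzx, if_neg hzy, hother z hzx hzy]
            ring
  · rintro ⟨α, b, x, y, hα, hxy, hf⟩
    have hne : x ≠ y := by
      rintro rfl
      simp at hxy
    have hs : Function.support (ZMod.dft f) = {x, y} := by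
      ext z
      rw [Function.mem_support, hf, deltaSet_singleton, deltaSet_singleton]
      by_cases hzx : z = x
      · subst hzx
        simp [hne, hα, ZMod.addChar_apply_ne_zero]
      · by_cases hzy : z = y
        · simp [hzy, hne.symm, hα, ZMod.addChar_apply_ne_zero]
        · simp [hzx, hzy]
    refine ⟨?_, by rw [hs, Set.ncard_pair hne]⟩
    have hfx : ∀ z, f z = ((p ^ 2 : ℕ) : ℂ)⁻¹ * α *
        (ZMod.stdAddChar (x * (z + b)) - ZMod.stdAddChar (y * (z + b))) := by
      intro z
      rw [← ZMod.dft.symm_apply_apply f, ZMod.invDFT_apply,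
        Finset.sum_eq_add x y hne (fun w _ hw => by
          rw [hf, deltaSet_singleton, deltaSet_singleton, if_neg hw.1, if_neg hw.2]; simp)
          (by simp) (by simp), hf, hf]
      simp only [deltaSet_singleton, if_neg hne, if_neg hne.symm, if_true, smul_eq_mul, mul_add,
        AddChar.map_add_eq_mul, mul_comm b]
      ring
    -- Since `x - y` is a unit, the two exponentials agree at exactly one point.
    have hsf : Function.support f = {-b}ᶜ := by
      ext z
      rw [Function.mem_support, hfx, Set.mem_compl_singleton_iff, not_iff_not]
      rw [mul_eq_zero, or_iff_right (mul_ne_zero hN hα), sub_eq_zero,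
        ZMod.injective_stdAddChar.eq_iff, ← sub_eq_zero, ← sub_mul,
        (isUnit_of_redMod_ne_zero hxy).mul_right_eq_zero, add_eq_zero_iff_eq_neg]
    rw [hsf, Set.ncard_compl, Set.ncard_singleton, Nat.card_zmod]

theorem hasEqualityCases_iff_exists {N : ℕ} [NeZero N] {k : ℕ} (hk : 1 ≤ k) :
    HasEqualityCases N k ↔ ∃ f, IsEqualityCase N k f := by
  simp only [isEqualityCase_iff hk]
  rfl

theorem hasEqualityCases_of_le {p : ℕ} [Fact p.Prime] {k : ℕ} (hk1 : 1 ≤ k) (hk : k ≤ p) :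
    HasEqualityCases (p ^ 2) k := by
  rw [hasEqualityCases_iff_exists hk1]
  obtain ⟨g, hg, hg'⟩ := ZMod.exists_ncard_support_dft_eq hk1 hk
  exact ⟨_, (isEqualityCase_low_iff hk1 hk _).2 ⟨g, 0, hg, hg', onCoset_digits 0 g⟩⟩

theorem hasEqualityCases_iff_of_ge {p : ℕ} [hp : Fact p.Prime] {k : ℕ} (hk : p ≤ k)
    (hkp : k ≤ p ^ 2) : HasEqualityCases (p ^ 2) k ↔ p ∣ k ∨ k = p ^ 2 - 1 := by
  have hpos := hp.out.two_le
  have hk1 : 1 ≤ k := by omega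
  rw [hasEqualityCases_iff_exists hk1]
  constructor
  · rintro ⟨f, hf⟩
    rw [isEqualityCase_iff hk1, meshulam_of_ge hk hkp] at hf
    rcases cosetSupport_dft_or_injOn_of_high hk hkp hf.1 hf.2 with ⟨b, hb⟩ | ⟨h, -⟩
    · obtain ⟨g, hg⟩ := eq_stdAddChar_mul_of_cosetSupport_dft hb
      exact Or.inl ⟨_, hf.1.symm.trans (ncard_support_of_eq_stdAddChar_mul hg).1⟩
    · exact Or.inr h
  · rintro (⟨r, rfl⟩ | rfl)
    · have hr1 : 1 ≤ r := Nat.one_le_iff_ne_zero.2 (by rintro rfl; simp at hk1)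
      have hr : r ≤ p := Nat.le_of_mul_le_mul_left (by rwa [← pow_two]) hp.out.pos
      obtain ⟨g, hg, hg'⟩ := ZMod.exists_ncard_support_dft_eq hr1 hr
      exact ⟨fun x => g (redMod p x), (isEqualityCase_mul_iff hr1 hr _).2
        ⟨0, g, hg, hg', fun x => by simp⟩⟩
    · refine ⟨ZMod.dft.symm fun z => deltaSet {1} z - deltaSet {0} z,
        (isEqualityCase_sq_sub_one_iff _).2 ⟨1, 0, 1, 0, one_ne_zero, by simp, fun z => ?_⟩⟩
      rw [LinearEquiv.apply_symm_apply]
      simp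

/-- The quotient `k / p` increases exactly at multiples of `p`. The strict inequality `p < k` keeps
`k - 1` in the range of the same formula. -/
theorem meshulam_lt_iff_of_gt {p : ℕ} [hp : Fact p.Prime] {k : ℕ} (hk : p < k)
    (hkp : k ≤ p ^ 2) : meshulam (p ^ 2) k < meshulam (p ^ 2) (k - 1) ↔ p ∣ k := by
  obtain ⟨j, rfl⟩ : ∃ j, k = j + 1 := ⟨k - 1, by omega⟩
  rw [Nat.add_sub_cancel, meshulam_of_ge hk.le hkp, meshulam_of_ge (by omega) (by omega)]
  have hle : (j + 1) / p ≤ p := Nat.div_le_of_le_mul (by rwa [← pow_two])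
  rw [Nat.succ_div] at hle ⊢
  split_ifs with h
  · rw [if_pos h] at hle
    simp only [h, iff_true]
    omega
  · simp only [h, iff_false]
    omega

/-- The disjunct `k = 1` encodes the convention `θ(0, G) = +∞`: `meshulam (p ^ 2) 0` is the infimum
of an empty set of naturals, which is `0`. -/
theorem mainTheorem3 (p : ℕ) [Fact p.Prime] :
    -- the values of Meshulam's function
    (∀ k : ℕ, 1 ≤ k → k ≤ p → meshulam (p ^ 2) k = p * (p - k + 1)) ∧
    (∀ k : ℕ, p ≤ k → k ≤ p ^ 2 → meshulam (p ^ 2) k = p - k / p + 1) ∧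
    -- existence of equality cases
    (∀ k : ℕ, 1 ≤ k → k ≤ p ^ 2 →
      (HasEqualityCases (p ^ 2) k ↔
        (k = 1 ∨ meshulam (p ^ 2) k < meshulam (p ^ 2) (k - 1)) ∨ k = p ^ 2 - 1)) ∧
    (∀ k : ℕ, p ≤ k → k ≤ p ^ 2 →
      (HasEqualityCases (p ^ 2) k ↔ p ∣ k ∨ k = p ^ 2 - 1)) ∧
    -- description of the equality cases for `k ≤ p`
    (∀ k : ℕ, 1 ≤ k → k ≤ p → ∀ f : ZMod (p ^ 2) → ℂ,
      (IsEqualityCase (p ^ 2) k f ↔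
        ∃ (g : ZMod p → ℂ) (a : ℕ), a < p ∧
          (Function.support g).ncard = k ∧
          (Function.support (ZMod.dft g)).ncard = p - k + 1 ∧
          ∀ x x' : ℕ, x < p → x' < p →
            f ((p * x + x' : ℕ) : ZMod (p ^ 2)) =
              g (x : ZMod p) *
                deltaSet (cosetH p (a : ZMod (p ^ 2))) (x' : ZMod (p ^ 2)))) ∧
    -- description of the equality cases for `k = p r`
    (∀ r : ℕ, 1 ≤ r → r ≤ p → ∀ f : ZMod (p ^ 2) → ℂ,
      (IsEqualityCase (p ^ 2) (p * r) f ↔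
        ∃ (χ : AddChar (ZMod (p ^ 2)) ℂ) (g : ZMod p → ℂ),
          (Function.support g).ncard = r ∧
          (Function.support (ZMod.dft g)).ncard = p - r + 1 ∧
          ∀ x x' : ℕ, x < p → x' < p →
            f ((p * x + x' : ℕ) : ZMod (p ^ 2)) =
              χ ((p * x + x' : ℕ) : ZMod (p ^ 2)) * g (x' : ZMod p))) ∧
    -- description of the equality cases for `k = p² - 1`
    (∀ f : ZMod (p ^ 2) → ℂ,
      (IsEqualityCase (p ^ 2) (p ^ 2 - 1) f ↔
        ∃ (α : ℂ) (χ : AddChar (ZMod (p ^ 2)) ℂ) (x y : ZMod (p ^ 2)),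
          α ≠ 0 ∧ x - y ∉ subgroupH p ∧
          ∀ z : ZMod (p ^ 2),
            ZMod.dft f z = α * χ z * (deltaSet {x} z - deltaSet {y} z))) := by
  have hp := (Fact.out : p.Prime)
  refine ⟨fun k => meshulam_of_le, fun k => meshulam_of_ge, ?_, fun k => hasEqualityCases_iff_of_ge,
    ?_, ?_, ?_⟩
  · intro k hk1 hkp
    rcases le_or_gt k p with hk | hk
    · simp only [hasEqualityCases_of_le hk1 hk, true_iff]
      rcases hk1.eq_or_lt with h | h
      · exact Or.inl (Or.inl h.symm)
      · refine Or.inl (Or.inr ?_)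
        rw [meshulam_of_le hk1 hk, meshulam_of_le (by omega) (by omega)]
        exact Nat.mul_lt_mul_of_pos_left (by omega) hp.pos
    · rw [hasEqualityCases_iff_of_ge hk.le hkp, meshulam_lt_iff_of_gt hk hkp]
      have : k ≠ 1 := by have := hp.two_le; omega
      simp [this]
  · intro k hk1 hk f
    rw [isEqualityCase_low_iff hk1 hk]
    have key : ∀ (g : ZMod p → ℂ) (a : ℕ), (∀ x x' : ℕ, x < p → x' < p →
        f ((p * x + x' : ℕ) : ZMod (p ^ 2)) =
          g (x : ZMod p) * deltaSet (cosetH p (a : ZMod (p ^ 2))) (x' : ZMod (p ^ 2))) ↔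
        ∀ a' t, f (digits p a' t) = if a' = (a : ZMod p) then g t else 0 := by
      intro g a
      rw [← forall_lt_iff_forall_digits
        (P := fun z a' t => f z = if a' = (a : ZMod p) then g t else 0)]
      simp only [deltaSet_cosetH, map_natCast, mul_ite, mul_one, mul_zero]
    simp only [key]
    constructor
    · rintro ⟨g, a, h1, h2, h3⟩
      refine ⟨g, a.val, ZMod.val_lt a, h1, h2, ?_⟩
      rwa [ZMod.natCast_zmod_val]
    · rintro ⟨g, a, -, h1, h2, h3⟩
      exact ⟨g, a, h1, h2, h3⟩
  · intro r hr1 hr f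
    rw [isEqualityCase_mul_iff hr1 hr]
    have key : ∀ (χ : AddChar (ZMod (p ^ 2)) ℂ) (g : ZMod p → ℂ), (∀ x x' : ℕ, x < p → x' < p →
        f ((p * x + x' : ℕ) : ZMod (p ^ 2)) =
          χ ((p * x + x' : ℕ) : ZMod (p ^ 2)) * g (x' : ZMod p)) ↔
        ∀ z, f z = χ z * g (redMod p z) := by
      intro χ g
      rw [forall_lt_iff_forall_digits (P := fun z a' _ => f z = χ z * g a')]
      constructor
      · intro h z
        obtain ⟨a, t, rfl⟩ := exists_digits z
        rw [h, redMod_digits]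
      · intro h a t
        rw [h, redMod_digits]
    simp only [key]
    constructor
    · rintro ⟨b, g, h1, h2, h3⟩
      exact ⟨ZMod.stdAddChar.mulShift b, g, h1, h2, h3⟩
    · rintro ⟨χ, g, h1, h2, h3⟩
      obtain ⟨b, hb⟩ := ZMod.exists_addChar_eq χ
      exact ⟨b, g, h1, h2, fun x => by rw [h3, hb]⟩
  · intro f
    rw [isEqualityCase_sq_sub_one_iff]
    simp only [mem_subgroupH_iff]
    constructor
    · rintro ⟨α, b, x, y, hα, hxy, h⟩
      exact ⟨α, ZMod.stdAddChar.mulShift b, x, y, hα, hxy, h⟩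
    · rintro ⟨α, χ, x, y, hα, hxy, h⟩
      obtain ⟨b, hb⟩ := ZMod.exists_addChar_eq χ
      exact ⟨α, b, x, y, hα, hxy, fun z => by rw [h, hb]⟩
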